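/- Consider an oscillator with annihilation operator $a$ coupled to a qubit with Pauli matrices $\sigma_x,\sigma_y,\sigma_z$ and $\sigma_\pm=(\sigma_x\pm i\sigma_y)/2$. Let $g,\Delta_A\in\mathbb R$, $\gamma>0$, $n_{\rm th}\ge 0$, and write $H^\times(X)=HX-XH$ and $\mathcal D[L](X)=LXL^\dagger-\tfrac12(L^\dagger LX+XL^\dagger L)$. Let $\varepsilon=|g|/\gamma$ and $$\mathcal L_A=-i\Delta_A(a^\dagger a)^\times+\gamma(1+n_{\rm th})\mathcal D[a]+\gamma n_{\rm th}\mathcal D[a^\dagger],\qquad \varepsilon\mathcal L_{\rm int}=-ig\,(a^\dagger\otimes\sigma_-+a\otimes\sigma_+)^\times ,$$ with $\mathcal L_{\rm int}=0$ if $g=0$, and let $\bar\rho_A=r^{a^\dagger a}/\mathrm{tr}(r^{a^\dagger a})$, $r=n_{\rm th}/(1+n_{\rm th})$. An adiabatic-elimination expansion in the partial-trace gauge, up to order $N$, consists of linear maps $\mathcal K_n$ from qubit operators to oscillator–qubit operators whose matrix elements in the Fock basis decay faster than every power of the occupation numbers, and linear maps $\mathcal L_{s,n}$ on qubit operators, such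 that $\mathcal K_0(\rho)=\bar\rho_A\otimes\rho$, $\mathcal L_{s,0}=0$, $\mathrm{tr}_A\circ\mathcal K_n=0$ for $1\le n\le N$, and the invariance equation $\mathcal K\circ\mathcal L_s=(\mathcal L_A\otimes\mathcal I_B+\varepsilon\mathcal L_{\rm int})\circ\mathcal K$ for $\mathcal K=\sum_n\varepsilon^n\mathcal K_n$, $\mathcal L_s=\sum_n\varepsilon^n\mathcal L_{s,n}$ holds at the orders $0,\dots,N$ of $\varepsilon$, that is, $(\mathcal L_A\otimes\mathcal I_B)\mathcal K_0=\mathcal K_0\mathcal L_{s,0}$ and $$\sum_{k=0}^{n}\mathcal K_k\circ\mathcal L_{s,n-k}=(\mathcal L_A\otimes\mathcal I_B)\circ\mathcal K_n+\mathcal L_{\rm int}\circ\mathcal K_{n-1}\qquad(1\le n\le N).$$ (i) There are sequences $(\mathcal K_n)_{n\ge0}$, $(\mathcal L_{s,n})_{n\ge0}$ that form such an expansion up to every order $N$. (ii) For every such expansion up to order $4$, $$\sum_{n=0}^{4}\varepsilon^n\mathcal L_{s,n}=-i\frac{\omega_B^{(4)}}2\sigma_z^\times+\gamma_-^{(4)}\mathcal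 D[\sigma_-]+\gamma_+^{(4)}\mathcal D[\sigma_+]+\gamma_\phi^{(4)}\mathcal D[\sigma_z],$$ where, with $n_+=n_{\rm th}$, $n_-=1+n_{\rm th}$, $\bar\gamma=\gamma+2i\Delta_A$, $x=2\Delta_A/\gamma$ and $$b_\pm=\frac{2g^2n_\pm}{\bar\gamma}+\frac{8g^4n_\pm^2}{\bar\gamma^3}+\frac{8g^4n_+n_-\,(1+8i\gamma\Delta_A/|\bar\gamma|^2)}{\bar\gamma^*|\bar\gamma|^2},$$ the real coefficients are $$\omega_B^{(4)}=\mathrm{Im}(b_-+b_+),\qquad\gamma_\pm^{(4)}=2\,\mathrm{Re}(b_\pm),\qquad\gamma_\phi^{(4)}=-\frac{8g^4n_+n_-(3-6x^2-x^4)}{\gamma^3(1+x^2)^3}.$$ (iii) $\gamma_\phi^{(4)}<0$ whenever $g\ne0$, $n_{\rm th}>0$ and $|\Delta_A|/\gamma<\tfrac12\sqrt{2\sqrt3-3}$. -/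

import Mathlib

open scoped Matrix Kronecker

noncomputable section

namespace JaynesCummings

/-! ### Operators as (possibly infinite) matrices -/

/-- Product of two operators given by their matrices in an orthonormal basis indexed by `ι`.
For finite `ι` this is the usual matrix product; every product used below over an infinite `ι` has
a band matrix (a polynomial in the ladder operators) as one of its factors, so that each of the sums
has finitely many nonzero terms. -/
def opMul {ι : Type*} (A B : Matrix ι ι ℂ) : Matrix ι ι ℂ :=
  fun i j => ∑' k, A i k * B k j

/-- The commutator superoperator `H^×(X) = H X - X H`. -/
def comm {ι : Type*} (H X : Matrix ι ι ℂ) : Matrix ι ι ℂ :=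
  opMul H X - opMul X H

/-- The dissipator `D[L](X) = L X L† - (L† L X + X L† L) / 2`. -/
def dissipator {ι : Type*} (L X : Matrix ι ι ℂ) : Matrix ι ι ℂ :=
  opMul (opMul L X) Lᴴ - (1 / 2 : ℂ) • (opMul (opMul Lᴴ L) X + opMul X (opMul Lᴴ L))

/-! ### The oscillator (fast subsystem `A`), in the Fock basis -/

/-- The annihilation operator, `a |n+1⟩ = √(n+1) |n⟩`, `a |0⟩ = 0`. -/
def annih : Matrix ℕ ℕ ℂ :=
  fun m n => if n = m + 1 then ((Real.sqrt (n : ℝ) : ℝ) : ℂ) else 0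

/-- The creation operator `a†`. -/
def creat : Matrix ℕ ℕ ℂ := annihᴴ

/-- The oscillator Lindbladian
`L_A = -i Δ (a† a)^× + γ (1 + n_th) D[a] + γ n_th D[a†]`. -/
def lindbladA (γ Δ nth : ℝ) (X : Matrix ℕ ℕ ℂ) : Matrix ℕ ℕ ℂ :=
  (-Complex.I * (Δ : ℂ)) • comm (opMul creat annih) X
    + ((γ * (1 + nth) : ℝ) : ℂ) • dissipator annih X
    + ((γ * nth : ℝ) : ℂ) • dissipator creat X

/-- The thermal state `r^(a† a) / tr (r^(a† a))` with `r = n_th / (1 + n_th)`. -/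
def thermal (nth : ℝ) : Matrix ℕ ℕ ℂ :=
  Matrix.diagonal fun m =>
    (((nth / (1 + nth)) ^ m / ∑' k : ℕ, (nth / (1 + nth)) ^ k : ℝ) : ℂ)

/-! ### The qubit (slow subsystem `B`) -/

/-- The Pauli matrix `σ_x`. -/
def sigmaX : Matrix (Fin 2) (Fin 2) ℂ := !![0, 1; 1, 0]

/-- The Pauli matrix `σ_y`. -/
def sigmaY : Matrix (Fin 2) (Fin 2) ℂ := !![0, -Complex.I; Complex.I, 0]

/-- The Pauli matrix `σ_z`. -/
def sigmaZ : Matrix (Fin 2) (Fin 2) ℂ := !![1, 0; 0, -1]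

/-- `σ_+ = (σ_x + i σ_y) / 2`. -/
def sigmaPlus : Matrix (Fin 2) (Fin 2) ℂ := (1 / 2 : ℂ) • (sigmaX + Complex.I • sigmaY)

/-- `σ_- = (σ_x - i σ_y) / 2`. -/
def sigmaMinus : Matrix (Fin 2) (Fin 2) ℂ := (1 / 2 : ℂ) • (sigmaX - Complex.I • sigmaY)

/-! ### The composite system -/

/-- Operators on the qubit. -/
abbrev OpB : Type := Matrix (Fin 2) (Fin 2) ℂ

/-- Operators on the composite system, in the product of the Fock basis and the qubit basis. -/
abbrev OpAB : Type := Matrix (ℕ × Fin 2) (ℕ × Fin 2) ℂ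

/-- The superoperator `S ⊗ I_B`: `S` acts on every qubit block. -/
def onA (S : Matrix ℕ ℕ ℂ → Matrix ℕ ℕ ℂ) (X : OpAB) : OpAB :=
  fun x y => S (fun m n => X (m, x.2) (n, y.2)) x.1 y.1

/-- The partial trace over the oscillator. -/
def partialTraceA (X : OpAB) : OpB :=
  fun i j => ∑' m : ℕ, X (m, i) (m, j)

/-- The matrix elements in the Fock basis decrease faster than every power of the occupation
numbers. Such operators are trace class, have finite moments of all orders, and are mapped to
operators of the same kind by left and right multiplication by `a` and `a†`. -/
def RapidDecay (X : OpAB) : Prop :=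
  ∀ k : ℕ, ∃ C : ℝ, ∀ x y : ℕ × Fin 2, (1 + (x.1 : ℝ) + (y.1 : ℝ)) ^ k * ‖X x y‖ ≤ C

/-- The parameter of the timescale separation, `ε = |g| / γ`. -/
def epsilon (g γ : ℝ) : ℝ := |g| / γ

/-- The interaction superoperator `L_int`, normalised by
`ε L_int = -i g (a† ⊗ σ_- + a ⊗ σ_+)^×`. (For `g = 0` both sides vanish.) -/
def lindbladInt (g γ : ℝ) (X : OpAB) : OpAB :=
  (-Complex.I * ((g / epsilon g γ : ℝ) : ℂ)) •
    comm (creat ⊗ₖ sigmaMinus + annih ⊗ₖ sigmaPlus) X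

/-- `K = ∑ ε^n K_n` and `L_s = ∑ ε^n L_{s,n}` solve the adiabatic elimination problem for
`L_tot = L_A ⊗ I_B + ε L_int` (here `L_B = 0`), in the gauge in which the reduced state is the
partial trace, at the orders `0, …, N` of `ε`. The fields `order_zero` and `order_succ` are the
coefficients of `ε^0` and `ε^(n+1)` in the invariance equation `K ∘ L_s = L_tot ∘ K`, and `gauge`
says that `tr_A ∘ K_n = 0` for `n ≥ 1`. -/
structure IsExpansion (g γ Δ nth : ℝ) (N : ℕ)
    (K : ℕ → OpB →ₗ[ℂ] OpAB) (L : ℕ → OpB →ₗ[ℂ] OpB) : Prop where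
  K_zero : ∀ ρ : OpB, K 0 ρ = thermal nth ⊗ₖ ρ
  L_zero : L 0 = 0
  rapid : ∀ n ≤ N, ∀ ρ : OpB, RapidDecay (K n ρ)
  gauge : ∀ n, 1 ≤ n → n ≤ N → ∀ ρ : OpB, partialTraceA (K n ρ) = 0
  order_zero : ∀ ρ : OpB, K 0 (L 0 ρ) = onA (lindbladA γ Δ nth) (K 0 ρ)
  order_succ : ∀ n, n + 1 ≤ N → ∀ ρ : OpB,
    ∑ k ∈ Finset.range (n + 2), K k (L (n + 1 - k) ρ)
      = onA (lindbladA γ Δ nth) (K (n + 1) ρ) + lindbladInt g γ (K n ρ)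

/-! ### The coefficients of the reduced generator -/

/-- `n_+ = n_th`. -/
def nPlus (nth : ℝ) : ℝ := nth

/-- `n_- = 1 + n_th`. -/
def nMinus (nth : ℝ) : ℝ := 1 + nth

/-- `γ̄ = γ + 2 i Δ`. -/
def gammaBar (γ Δ : ℝ) : ℂ := (γ : ℂ) + 2 * Complex.I * (Δ : ℂ)

/-- The complex number `b_±`, where `n` stands for `n_±`. -/
def bCoeff (g γ Δ nth n : ℝ) : ℂ :=
  2 * (g : ℂ) ^ 2 * (n : ℂ) / gammaBar γ Δ
    + 8 * (g : ℂ) ^ 4 * (n : ℂ) ^ 2 / gammaBar γ Δ ^ 3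
    + 8 * (g : ℂ) ^ 4 * (nPlus nth : ℂ) * (nMinus nth : ℂ)
        * (1 + 8 * Complex.I * (γ : ℂ) * (Δ : ℂ) / (‖gammaBar γ Δ‖ : ℂ) ^ 2)
      / (starRingEnd ℂ (gammaBar γ Δ) * (‖gammaBar γ Δ‖ : ℂ) ^ 2)

/-- `ω_B = Im (b_- + b_+)`. -/
def omegaB (g γ Δ nth : ℝ) : ℝ :=
  (bCoeff g γ Δ nth (nMinus nth) + bCoeff g γ Δ nth (nPlus nth)).im

/-- `γ_- = 2 Re b_-`. -/
def gammaMinus (g γ Δ nth : ℝ) : ℝ := 2 * (bCoeff g γ Δ nth (nMinus nth)).re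

/-- `γ_+ = 2 Re b_+`. -/
def gammaPlus (g γ Δ nth : ℝ) : ℝ := 2 * (bCoeff g γ Δ nth (nPlus nth)).re

/-- The dephasing coefficient `γ_φ`. -/
def gammaPhi (g γ Δ nth : ℝ) : ℝ :=
  -(8 * g ^ 4 * nPlus nth * nMinus nth * (3 - 6 * (2 * Δ / γ) ^ 2 - (2 * Δ / γ) ^ 4))
    / (γ ^ 3 * (1 + (2 * Δ / γ) ^ 2) ^ 3)

end JaynesCummings

end

open scoped Matrix Kronecker

noncomputable section

namespace JaynesCummings

/-! ### Ladder operators acting from the left and from the right -/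

/-! The oscillator generator is triangular with respect to ladder-operator monomials, both on states
and on observables. Both halves of the theorem rest on this.

Existence: since `a ρ = r ρ a` for the thermal state `ρ`, the span of the operators `a†^j ρ a^k` is
stable under all four one-sided multiplications by `a` and `a†`. On it the generator sends `(j, k)`
to a multiple of itself plus a multiple of `(j-1, k-1)` (`lindbladEnd_ladder`). The diagonal rate
vanishes only at `(0, 0)`, so back substitution inverts the generator modulo `ρ`, and correcting the
trace gives a generalised inverse with values in traceless operators (`exists_generalised_inverse`).
A formal recursion then yields every order: the trace of each equation fixes `L_{s,n}`, which is
precisely the solvability condition for `K_n` (`exists_recursive_expansion`).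

Formula: an arbitrary expansion need not lie in that span, so nothing is assumed about the form of
`K_n`. Instead the normally ordered moments `tr_A (a^k K_n a†^j)` are computed. Rapid decay makes
them finite and justifies cyclicity of the trace, and the dual triangularity (`moment_lindbladEnd`)
turns the invariance equation into a recursion for qubit operators (`IsExpansion.momentB_succ`). Its
zeroth moment expresses `L_{s,n+1}` through first moments of `K_n` (`IsExpansion.L_succ`). Hence
only finitely many moments enter up to order four; comparing the resulting `2 × 2` matrices with the
Lindblad form gives the coefficients.

The sign of the dephasing coefficient is that of a quadratic in `x ^ 2` whose positive root is `2√3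
- 3`. -/

/-- Left multiplication by the annihilation operator. -/
def leftAnnih : Module.End ℂ (Matrix ℕ ℕ ℂ) where
  toFun X := fun m n => ((Real.sqrt (m + 1 : ℝ) : ℝ) : ℂ) * X (m + 1) n
  map_add' X Y := by funext m n; exact mul_add _ _ _
  map_smul' c X := by funext m n; exact mul_left_comm _ _ _

/-- Left multiplication by the creation operator. -/
def leftCreat : Module.End ℂ (Matrix ℕ ℕ ℂ) where
  toFun X := fun m n => ((Real.sqrt (m : ℝ) : ℝ) : ℂ) * X (m - 1) n
  map_add' X Y := by funext m n; exact mul_add _ _ _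
  map_smul' c X := by funext m n; exact mul_left_comm _ _ _

/-- Right multiplication by the annihilation operator. -/
def rightAnnih : Module.End ℂ (Matrix ℕ ℕ ℂ) where
  toFun X := fun m n => ((Real.sqrt (n : ℝ) : ℝ) : ℂ) * X m (n - 1)
  map_add' X Y := by funext m n; exact mul_add _ _ _
  map_smul' c X := by funext m n; exact mul_left_comm _ _ _

/-- Right multiplication by the creation operator. -/
def rightCreat : Module.End ℂ (Matrix ℕ ℕ ℂ) where
  toFun X := fun m n => ((Real.sqrt (n + 1 : ℝ) : ℝ) : ℂ) * X m (n + 1)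
  map_add' X Y := by funext m n; exact mul_add _ _ _
  map_smul' c X := by funext m n; exact mul_left_comm _ _ _

theorem leftAnnih_apply (X : Matrix ℕ ℕ ℂ) (m n : ℕ) :
    leftAnnih X m n = ((Real.sqrt (m + 1 : ℝ) : ℝ) : ℂ) * X (m + 1) n := rfl

theorem leftCreat_apply (X : Matrix ℕ ℕ ℂ) (m n : ℕ) :
    leftCreat X m n = ((Real.sqrt (m : ℝ) : ℝ) : ℂ) * X (m - 1) n := rfl

theorem rightAnnih_apply (X : Matrix ℕ ℕ ℂ) (m n : ℕ) :
    rightAnnih X m n = ((Real.sqrt (n : ℝ) : ℝ) : ℂ) * X m (n - 1) := rfl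

theorem rightCreat_apply (X : Matrix ℕ ℕ ℂ) (m n : ℕ) :
    rightCreat X m n = ((Real.sqrt (n + 1 : ℝ) : ℝ) : ℂ) * X m (n + 1) := rfl

theorem sqrt_cast_succ_mul_self (n : ℕ) :
    ((Real.sqrt (n + 1 : ℝ) : ℝ) : ℂ) * ((Real.sqrt (n + 1 : ℝ) : ℝ) : ℂ) = n + 1 := by
  rw [← Complex.ofReal_mul, Real.mul_self_sqrt (by positivity)]; simp

theorem annih_apply (m n : ℕ) :
    annih m n = if n = m + 1 then ((Real.sqrt (m + 1 : ℝ) : ℝ) : ℂ) else 0 := by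
  unfold annih
  split_ifs with h
  · subst h; simp
  · rfl

theorem creat_apply (m n : ℕ) :
    creat m n = if m = n + 1 then ((Real.sqrt (m : ℝ) : ℝ) : ℂ) else 0 := by
  simp only [creat, Matrix.conjTranspose_apply, annih]
  split_ifs <;> simp

theorem creat_apply' (m n : ℕ) :
    creat m n = if m = n + 1 then ((Real.sqrt (n + 1 : ℝ) : ℝ) : ℂ) else 0 := by
  rw [creat_apply]
  split_ifs with h
  · subst h; simp
  · rfl

theorem opMul_annih (X : Matrix ℕ ℕ ℂ) : opMul annih X = leftAnnih X := by
  ext m n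
  rw [opMul, tsum_eq_single (m + 1)]
  · simp [annih_apply, leftAnnih_apply]
  · intro k hk; simp [annih_apply, hk]

theorem opMul_creat (X : Matrix ℕ ℕ ℂ) : opMul creat X = leftCreat X := by
  ext m n
  rw [opMul, tsum_eq_single (m - 1)]
  · rcases m with _ | m <;> simp [creat_apply, leftCreat_apply]
  · intro k hk
    rw [creat_apply, if_neg (by omega), zero_mul]

theorem opMul_right_annih (X : Matrix ℕ ℕ ℂ) : opMul X annih = rightAnnih X := by
  ext m n
  rw [opMul, tsum_eq_single (n - 1)]
  · rcases n with _ | n <;> simp [annih, rightAnnih_apply, mul_comm]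
  · intro k hk
    rw [annih, if_neg (by omega), mul_zero]

theorem opMul_right_creat (X : Matrix ℕ ℕ ℂ) : opMul X creat = rightCreat X := by
  ext m n
  rw [opMul, tsum_eq_single (n + 1)]
  · simp [creat_apply, rightCreat_apply, mul_comm]
  · intro k hk; simp [creat_apply, hk]

theorem opMul_diagonal (d : ℕ → ℂ) (X : Matrix ℕ ℕ ℂ) :
    opMul (Matrix.diagonal d) X = fun m n => d m * X m n := by
  ext m n
  rw [opMul, tsum_eq_single m]
  · simp
  · intro k hk; rw [Matrix.diagonal_apply_ne' _ hk, zero_mul]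

theorem opMul_right_diagonal (d : ℕ → ℂ) (X : Matrix ℕ ℕ ℂ) :
    opMul X (Matrix.diagonal d) = fun m n => d n * X m n := by
  ext m n
  rw [opMul, tsum_eq_single n]
  · simp [mul_comm]
  · intro k hk; rw [Matrix.diagonal_apply_ne _ hk, mul_zero]

theorem opMul_creat_annih : opMul creat annih = Matrix.diagonal fun m : ℕ => (m : ℂ) := by
  ext m n
  rw [opMul_creat, leftCreat_apply, annih]
  rcases m with _ | m
  · rcases eq_or_ne 0 n with h | h
    · subst h; simp
    · simp [h]
  · rcases eq_or_ne (m + 1) n with h | h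
    · subst h; simp [sqrt_cast_succ_mul_self]
    · simp [h, h.symm]

theorem opMul_annih_creat : opMul annih creat = Matrix.diagonal fun m : ℕ => (m + 1 : ℂ) := by
  ext m n
  rw [opMul_annih, leftAnnih_apply, creat_apply']
  rcases eq_or_ne m n with h | h
  · subst h; simp [sqrt_cast_succ_mul_self]
  · simp [h]

theorem leftAnnih_leftCreat (X : Matrix ℕ ℕ ℂ) :
    leftAnnih (leftCreat X) = fun (m n : ℕ) => ((m : ℂ) + 1) * X m n := by
  ext m n
  simp [leftAnnih_apply, leftCreat_apply, ← mul_assoc, sqrt_cast_succ_mul_self]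

theorem leftCreat_leftAnnih (X : Matrix ℕ ℕ ℂ) :
    leftCreat (leftAnnih X) = fun (m n : ℕ) => (m : ℂ) * X m n := by
  ext m n
  rcases m with _ | m <;>
  simp [leftAnnih_apply, leftCreat_apply, ← mul_assoc, sqrt_cast_succ_mul_self]

theorem rightCreat_rightAnnih (X : Matrix ℕ ℕ ℂ) :
    rightCreat (rightAnnih X) = fun (m n : ℕ) => ((n : ℂ) + 1) * X m n := by
  ext m n
  simp [rightAnnih_apply, rightCreat_apply, ← mul_assoc, sqrt_cast_succ_mul_self]

theorem rightAnnih_rightCreat (X : Matrix ℕ ℕ ℂ) :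
    rightAnnih (rightCreat X) = fun (m n : ℕ) => (n : ℂ) * X m n := by
  ext m n
  rcases n with _ | n <;>
  simp [rightAnnih_apply, rightCreat_apply, ← mul_assoc, sqrt_cast_succ_mul_self]

/-- The canonical commutation relation for left multiplications. -/
theorem leftAnnih_leftCreat_eq (X : Matrix ℕ ℕ ℂ) :
    leftAnnih (leftCreat X) = leftCreat (leftAnnih X) + X := by
  rw [leftAnnih_leftCreat, leftCreat_leftAnnih]
  funext m n; exact add_one_mul _ _

/-- The canonical commutation relation for right multiplications. -/
theorem rightCreat_rightAnnih_eq (X : Matrix ℕ ℕ ℂ) :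
    rightCreat (rightAnnih X) = rightAnnih (rightCreat X) + X := by
  rw [rightCreat_rightAnnih, rightAnnih_rightCreat]
  funext m n; exact add_one_mul _ _

theorem leftAnnih_rightAnnih (X : Matrix ℕ ℕ ℂ) :
    leftAnnih (rightAnnih X) = rightAnnih (leftAnnih X) := by
  ext m n; simp [leftAnnih_apply, rightAnnih_apply]; ring

theorem leftAnnih_rightCreat (X : Matrix ℕ ℕ ℂ) :
    leftAnnih (rightCreat X) = rightCreat (leftAnnih X) := by
  ext m n; simp [leftAnnih_apply, rightCreat_apply]; ring

theorem leftCreat_rightAnnih (X : Matrix ℕ ℕ ℂ) :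
    leftCreat (rightAnnih X) = rightAnnih (leftCreat X) := by
  ext m n; simp [leftCreat_apply, rightAnnih_apply]; ring

theorem leftCreat_rightCreat (X : Matrix ℕ ℕ ℂ) :
    leftCreat (rightCreat X) = rightCreat (leftCreat X) := by
  ext m n; simp [leftCreat_apply, rightCreat_apply]; ring

/-- The oscillator Lindbladian as a linear map, written with ladder operators. -/
def lindbladEnd (γ Δ nth : ℝ) : Module.End ℂ (Matrix ℕ ℕ ℂ) :=
  (-Complex.I * (Δ : ℂ)) • (leftCreat ∘ₗ leftAnnih - rightAnnih ∘ₗ rightCreat)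
    + ((γ * (1 + nth) : ℝ) : ℂ) • (leftAnnih ∘ₗ rightCreat
        - (1 / 2 : ℂ) • (leftCreat ∘ₗ leftAnnih + rightAnnih ∘ₗ rightCreat))
    + ((γ * nth : ℝ) : ℂ) • (leftCreat ∘ₗ rightAnnih
        - (1 / 2 : ℂ) • (leftAnnih ∘ₗ leftCreat + rightCreat ∘ₗ rightAnnih))

/-- This removes the infinite sums from the generator: afterwards only the commutation relations of
four linear maps matter. -/
theorem lindbladA_eq (γ Δ nth : ℝ) (X : Matrix ℕ ℕ ℂ) :
    lindbladA γ Δ nth X = lindbladEnd γ Δ nth X := by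
  have h : creatᴴ = annih := by simp [creat]
  have h' : annihᴴ = creat := rfl
  simp only [lindbladA, comm, dissipator, h, h', opMul_creat_annih, opMul_annih_creat,
    opMul_diagonal, opMul_right_diagonal]
  simp only [lindbladEnd, LinearMap.add_apply, LinearMap.smul_apply,
    LinearMap.sub_apply, LinearMap.comp_apply, leftCreat_leftAnnih, rightAnnih_rightCreat,
    leftAnnih_leftCreat, rightCreat_rightAnnih, opMul_annih, opMul_creat, opMul_right_creat,
    opMul_right_annih, leftAnnih_rightCreat, leftCreat_rightAnnih]

/-! ### Rapidly decreasing matrices and the trace -/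

/-- Matrices whose entries decrease faster than every power of the indices. -/
def rapid : Submodule ℂ (Matrix ℕ ℕ ℂ) where
  carrier := {X | ∀ k : ℕ, ∃ C : ℝ, ∀ m n : ℕ, (1 + (m : ℝ) + (n : ℝ)) ^ k * ‖X m n‖ ≤ C}
  add_mem' {X Y} hX hY k := by
    obtain ⟨C, hC⟩ := hX k
    obtain ⟨D, hD⟩ := hY k
    refine ⟨C + D, fun m n => ?_⟩
    calc (1 + (m : ℝ) + n) ^ k * ‖(X + Y) m n‖
        ≤ (1 + (m : ℝ) + n) ^ k * (‖X m n‖ + ‖Y m n‖) := by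
          gcongr; exact norm_add_le _ _
      _ ≤ C + D := by rw [mul_add]; exact add_le_add (hC m n) (hD m n)
  zero_mem' k := ⟨0, fun m n => by simp⟩
  smul_mem' c X hX k := by
    obtain ⟨C, hC⟩ := hX k
    refine ⟨‖c‖ * C, fun m n => ?_⟩
    have := mul_le_mul_of_nonneg_left (hC m n) (norm_nonneg c)
    calc (1 + (m : ℝ) + n) ^ k * ‖(c • X) m n‖
        = ‖c‖ * ((1 + (m : ℝ) + n) ^ k * ‖X m n‖) := by
          rw [Matrix.smul_apply, norm_smul]; ring
      _ ≤ _ := this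

theorem transpose_mem_rapid {X : Matrix ℕ ℕ ℂ} (hX : X ∈ rapid) : Xᵀ ∈ rapid := by
  intro k
  obtain ⟨C, hC⟩ := hX k
  refine ⟨C, fun m n => ?_⟩
  have := hC n m
  rwa [add_right_comm] at this

/-- The factor `√(m+1)` costs one power of the weight, so the bound of exponent `k + 1` gives the
one of exponent `k`. -/
theorem leftAnnih_mem_rapid {X : Matrix ℕ ℕ ℂ} (hX : X ∈ rapid) : leftAnnih X ∈ rapid := by
  intro k
  obtain ⟨C, hC⟩ := hX (k + 1)
  refine ⟨C, fun m n => le_trans ?_ (hC (m + 1) n)⟩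
  have h : Real.sqrt (m + 1 : ℝ) ≤ 1 + ((m + 1 : ℕ) : ℝ) + n := by
    have h1 : Real.sqrt (m + 1 : ℝ) ≤ m + 1 := by
      rw [Real.sqrt_le_left (by positivity)]
      nlinarith [(Nat.cast_nonneg m : (0 : ℝ) ≤ m)]
    push_cast
    linarith [(Nat.cast_nonneg n : (0 : ℝ) ≤ n)]
  rw [leftAnnih_apply, norm_mul, Complex.norm_real, Real.norm_of_nonneg (Real.sqrt_nonneg _),
    pow_succ, mul_assoc]
  gcongr
  simp

theorem leftCreat_mem_rapid {X : Matrix ℕ ℕ ℂ} (hX : X ∈ rapid) : leftCreat X ∈ rapid := by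
  intro k
  obtain ⟨C, hC⟩ := hX (k + 1)
  have hC0 : 0 ≤ C := le_trans (by positivity) (hC 0 0)
  -- Here the index shift goes the other way: passing from row `m` to row `m + 1` at most doubles
  -- the weight.
  refine ⟨2 ^ k * C, fun m n => ?_⟩
  rcases m with _ | m
  · simp [leftCreat_apply]; positivity
  · refine le_trans ?_ (mul_le_mul_of_nonneg_left (hC m n) (by positivity : (0 : ℝ) ≤ 2 ^ k))
    have h : Real.sqrt (((m + 1 : ℕ)) : ℝ) ≤ 1 + (m : ℝ) + n := by
      have h1 : Real.sqrt ((m + 1 : ℕ) : ℝ) ≤ m + 1 := by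
        rw [Real.sqrt_le_left (by positivity)]
        push_cast
        nlinarith [(Nat.cast_nonneg m : (0 : ℝ) ≤ m)]
      linarith [(Nat.cast_nonneg n : (0 : ℝ) ≤ n)]
    rw [leftCreat_apply, norm_mul, Complex.norm_real, Real.norm_of_nonneg (Real.sqrt_nonneg _),
      pow_succ, ← mul_assoc, ← mul_assoc, ← mul_assoc, ← mul_pow, Nat.add_sub_cancel]
    gcongr
    push_cast
    linarith [(Nat.cast_nonneg n : (0 : ℝ) ≤ n), (Nat.cast_nonneg m : (0 : ℝ) ≤ m)]

theorem rightAnnih_mem_rapid {X : Matrix ℕ ℕ ℂ} (hX : X ∈ rapid) : rightAnnih X ∈ rapid :=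
  transpose_mem_rapid (leftCreat_mem_rapid (transpose_mem_rapid hX))

theorem rightCreat_mem_rapid {X : Matrix ℕ ℕ ℂ} (hX : X ∈ rapid) : rightCreat X ∈ rapid :=
  transpose_mem_rapid (leftAnnih_mem_rapid (transpose_mem_rapid hX))

theorem lindbladEnd_mem_rapid (γ Δ nth : ℝ) {X : Matrix ℕ ℕ ℂ} (hX : X ∈ rapid) :
    lindbladEnd γ Δ nth X ∈ rapid := by
  have h1 := leftCreat_mem_rapid (leftAnnih_mem_rapid hX)
  have h2 := rightAnnih_mem_rapid (rightCreat_mem_rapid hX)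
  have h3 := leftAnnih_mem_rapid (leftCreat_mem_rapid hX)
  have h4 := rightCreat_mem_rapid (rightAnnih_mem_rapid hX)
  have h5 := leftAnnih_mem_rapid (rightCreat_mem_rapid hX)
  have h6 := leftCreat_mem_rapid (rightAnnih_mem_rapid hX)
  exact rapid.add_mem (rapid.add_mem (rapid.smul_mem _ (rapid.sub_mem h1 h2))
    (rapid.smul_mem _ (rapid.sub_mem h5 (rapid.smul_mem _ (rapid.add_mem h1 h2)))))
    (rapid.smul_mem _ (rapid.sub_mem h6 (rapid.smul_mem _ (rapid.add_mem h3 h4))))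

theorem summable_diag {X : Matrix ℕ ℕ ℂ} (hX : X ∈ rapid) : Summable fun m => X m m := by
  obtain ⟨C, hC⟩ := hX 2
  have hs : Summable fun m : ℕ => C * (1 / ((m + 1 : ℕ) : ℝ) ^ 2) :=
    ((summable_nat_add_iff 1).2 (Real.summable_one_div_nat_pow.2 one_lt_two)).mul_left C
  refine Summable.of_norm_bounded hs fun m => ?_
  rw [mul_one_div, le_div_iff₀ (by positivity)]
  refine le_trans ?_ (hC m m)
  rw [mul_comm]
  gcongr
  push_cast
  linarith [(Nat.cast_nonneg m : (0 : ℝ) ≤ m)]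

/-- The trace of an infinite matrix. -/
def tr (X : Matrix ℕ ℕ ℂ) : ℂ := ∑' m, X m m

theorem tr_add {X Y : Matrix ℕ ℕ ℂ} (hX : X ∈ rapid) (hY : Y ∈ rapid) :
    tr (X + Y) = tr X + tr Y :=
  (summable_diag hX).tsum_add (summable_diag hY)

theorem tr_smul (c : ℂ) (X : Matrix ℕ ℕ ℂ) : tr (c • X) = c * tr X :=
  tsum_mul_left

/-- Cyclicity of the trace, without any decay assumption: the two diagonals agree up to a shift by
one, and the extra term at index `0` carries the factor `√0`. -/
theorem tr_leftCreat (X : Matrix ℕ ℕ ℂ) : tr (leftCreat X) = tr (rightCreat X) := by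
  have h : Function.support (fun m => leftCreat X m m) ⊆ Set.range Nat.succ := by
    intro m hm
    rcases m with _ | m
    · simp [leftCreat_apply] at hm
    · exact ⟨m, rfl⟩
  rw [tr, ← Nat.succ_injective.tsum_eq h]
  simp [tr, leftCreat_apply, rightCreat_apply]

theorem tr_rightAnnih (X : Matrix ℕ ℕ ℂ) : tr (rightAnnih X) = tr (leftAnnih X) :=
  tr_leftCreat Xᵀ

/-! ### Moments -/

/-- The moment `tr (a^k X a†^j)`. -/
def moment (j k : ℕ) (X : Matrix ℕ ℕ ℂ) : ℂ := tr ((leftAnnih ^ k) ((rightCreat ^ j) X))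

theorem pow_mem_rapid {f : Module.End ℂ (Matrix ℕ ℕ ℂ)} (hf : ∀ X ∈ rapid, f X ∈ rapid) (k : ℕ)
    {X : Matrix ℕ ℕ ℂ} (hX : X ∈ rapid) : (f ^ k) X ∈ rapid := by
  induction k with
  | zero => exact hX
  | succ k ih => rw [pow_succ']; exact hf _ ih

theorem moment_mem_rapid (j k : ℕ) {X : Matrix ℕ ℕ ℂ} (hX : X ∈ rapid) :
    (leftAnnih ^ k) ((rightCreat ^ j) X) ∈ rapid :=
  pow_mem_rapid (fun _ => leftAnnih_mem_rapid) k (pow_mem_rapid (fun _ => rightCreat_mem_rapid) j hX)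

theorem moment_add (j k : ℕ) {X Y : Matrix ℕ ℕ ℂ} (hX : X ∈ rapid) (hY : Y ∈ rapid) :
    moment j k (X + Y) = moment j k X + moment j k Y := by
  rw [moment, map_add, map_add]
  exact tr_add (moment_mem_rapid j k hX) (moment_mem_rapid j k hY)

theorem moment_smul (j k : ℕ) (c : ℂ) (X : Matrix ℕ ℕ ℂ) :
    moment j k (c • X) = c * moment j k X := by
  rw [moment, map_smul, map_smul, tr_smul]; rfl

theorem moment_neg (j k : ℕ) (X : Matrix ℕ ℕ ℂ) : moment j k (-X) = -moment j k X := by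
  rw [← neg_one_smul ℂ, moment_smul, neg_one_mul]

theorem moment_sub (j k : ℕ) {X Y : Matrix ℕ ℕ ℂ} (hX : X ∈ rapid) (hY : Y ∈ rapid) :
    moment j k (X - Y) = moment j k X - moment j k Y := by
  rw [sub_eq_add_neg, moment_add j k hX (rapid.neg_mem hY), moment_neg, sub_eq_add_neg]

theorem moment_sum (j k : ℕ) {ι : Type*} (s : Finset ι) (X : ι → Matrix ℕ ℕ ℂ)
    (hX : ∀ i ∈ s, X i ∈ rapid) : moment j k (∑ i ∈ s, X i) = ∑ i ∈ s, moment j k (X i) := by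
  classical
  induction s using Finset.induction_on with
  | empty => simpa using moment_smul j k 0 0
  | insert i s hi ih =>
    rw [Finset.sum_insert hi, Finset.sum_insert hi, moment_add j k (hX i (by simp))
      (rapid.sum_mem fun i hi => hX i (by simp [hi])), ih fun i hi => hX i (by simp [hi])]

theorem commute_left_right : Commute leftAnnih rightCreat :=
  LinearMap.ext leftAnnih_rightCreat

theorem moment_leftAnnih (j k : ℕ) (X : Matrix ℕ ℕ ℂ) :
    moment j k (leftAnnih X) = moment j (k + 1) X := by
  have h := LinearMap.congr_fun ((commute_left_right.pow_right j).eq) X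
  simp only [Module.End.mul_apply] at h
  rw [moment, moment, ← h, pow_succ]; rfl

theorem moment_rightCreat (j k : ℕ) (X : Matrix ℕ ℕ ℂ) :
    moment j k (rightCreat X) = moment (j + 1) k X := by
  rw [moment, moment, pow_succ rightCreat]; rfl

/-- The commutator `[a^k, a†] = k a^(k-1)`. At `k = 0` the truncated exponent is harmless because
its coefficient vanishes. -/
theorem leftAnnih_pow_leftCreat (k : ℕ) (X : Matrix ℕ ℕ ℂ) :
    (leftAnnih ^ k) (leftCreat X)
      = leftCreat ((leftAnnih ^ k) X) + (k : ℂ) • (leftAnnih ^ (k - 1)) X := by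
  induction k with
  | zero => simp
  | succ k ih =>
    rw [pow_succ', Module.End.mul_apply, ih, map_add, map_smul, leftAnnih_leftCreat_eq,
      Module.End.mul_apply, Nat.add_sub_cancel]
    rcases k with _ | k
    · simp
    · have h : leftAnnih ((leftAnnih ^ k) X) = (leftAnnih ^ (k + 1)) X := by rw [pow_succ']; rfl
      rw [Nat.add_sub_cancel, h, add_assoc]
      congr 1
      push_cast
      module

theorem rightCreat_pow_rightAnnih (k : ℕ) (X : Matrix ℕ ℕ ℂ) :
    (rightCreat ^ k) (rightAnnih X)
      = rightAnnih ((rightCreat ^ k) X) + (k : ℂ) • (rightCreat ^ (k - 1)) X := by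
  induction k with
  | zero => simp
  | succ k ih =>
    rw [pow_succ', Module.End.mul_apply, ih, map_add, map_smul, rightCreat_rightAnnih_eq,
      Module.End.mul_apply, Nat.add_sub_cancel]
    rcases k with _ | k
    · simp
    · have h : rightCreat ((rightCreat ^ k) X) = (rightCreat ^ (k + 1)) X := by rw [pow_succ']; rfl
      rw [Nat.add_sub_cancel, h, add_assoc]
      congr 1
      push_cast
      module

/-- Commuting `a†` to the left of `a^k` leaves the lower moment; cyclicity then carries it to the
right, where it raises `j`. -/
theorem moment_leftCreat (j k : ℕ) {X : Matrix ℕ ℕ ℂ} (hX : X ∈ rapid) :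
    moment j k (leftCreat X) = moment (j + 1) k X + k * moment j (k - 1) X := by
  have hc : Commute leftCreat rightCreat := LinearMap.ext leftCreat_rightCreat
  have h := LinearMap.congr_fun ((hc.pow_right j).eq) X
  have h' := LinearMap.congr_fun ((commute_left_right.pow_left k).eq) ((rightCreat ^ j) X)
  simp only [Module.End.mul_apply] at h h'
  rw [moment, ← h, leftAnnih_pow_leftCreat, tr_add (leftCreat_mem_rapid (moment_mem_rapid j k hX))
    (rapid.smul_mem _ (moment_mem_rapid j _ hX)), tr_smul, tr_leftCreat, ← h',
    ← Module.End.mul_apply rightCreat, ← pow_succ']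
  rfl

theorem moment_rightAnnih (j k : ℕ) {X : Matrix ℕ ℕ ℂ} (hX : X ∈ rapid) :
    moment j k (rightAnnih X) = moment j (k + 1) X + j * moment (j - 1) k X := by
  have hc : Commute leftAnnih rightAnnih := LinearMap.ext leftAnnih_rightAnnih
  have h := LinearMap.congr_fun ((hc.pow_left k).eq) ((rightCreat ^ j) X)
  simp only [Module.End.mul_apply] at h
  rw [moment, rightCreat_pow_rightAnnih, map_add, map_smul, h,
    tr_add (rightAnnih_mem_rapid (moment_mem_rapid j k hX))
    (rapid.smul_mem _ (moment_mem_rapid _ k hX)), tr_smul, tr_rightAnnih,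
    ← Module.End.mul_apply leftAnnih, ← pow_succ']
  rfl

/-- The relaxation rates of the oscillator: `-(γ/2)(j + k) - iΔ(k - j)`. -/
def rate (γ Δ : ℝ) (j k : ℕ) : ℂ :=
  -((γ : ℂ) / 2) * (j + k) - Complex.I * Δ * (k - j)

theorem rate_ne_zero {γ : ℝ} (hγ : 0 < γ) (Δ : ℝ) {j k : ℕ} (h : 0 < j + k) :
    rate γ Δ j k ≠ 0 := by
  intro h0
  have h1 : -(γ / 2) * ((j : ℝ) + k) = 0 := by
    have := congrArg Complex.re h0
    simpa [rate] using this
  have h2 : (0 : ℝ) < (j : ℝ) + k := by exact_mod_cast h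
  nlinarith [mul_pos hγ h2]

/-- The moments `(j+1, k+1)` cancel within the commutator and within each dissipator separately, so
the moment equations close downwards. Only heating, of rate `γ nth`, couples `(j, k)` to `(j-1,
k-1)`. -/
theorem moment_lindbladEnd (γ Δ nth : ℝ) (j k : ℕ) {X : Matrix ℕ ℕ ℂ} (hX : X ∈ rapid) :
    moment j k (lindbladEnd γ Δ nth X)
      = rate γ Δ j k * moment j k X + γ * nth * j * k * moment (j - 1) (k - 1) X := by
  have ha := leftAnnih_mem_rapid hX
  have hb := leftCreat_mem_rapid hX
  have hc := rightAnnih_mem_rapid hX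
  have hd := rightCreat_mem_rapid hX
  have h1 := leftCreat_mem_rapid ha
  have h2 := rightAnnih_mem_rapid hd
  have h3 := leftAnnih_mem_rapid hb
  have h4 := rightCreat_mem_rapid hc
  have h5 := leftAnnih_mem_rapid hd
  have h6 := leftCreat_mem_rapid hc
  have e1 : moment j k (leftCreat (leftAnnih X)) = moment (j + 1) (k + 1) X + k * moment j k X := by
    rw [moment_leftCreat _ _ ha, moment_leftAnnih, moment_leftAnnih]
    rcases k with _ | k <;> simp
  have e2 : moment j k (rightAnnih (rightCreat X))
      = moment (j + 1) (k + 1) X + j * moment j k X := by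
    rw [moment_rightAnnih _ _ hd, moment_rightCreat, moment_rightCreat]
    rcases j with _ | j <;> simp
  have e3 : moment j k (leftAnnih (leftCreat X))
      = moment (j + 1) (k + 1) X + (k + 1) * moment j k X := by
    rw [moment_leftAnnih, moment_leftCreat _ _ hX]; simp
  have e4 : moment j k (rightCreat (rightAnnih X))
      = moment (j + 1) (k + 1) X + (j + 1) * moment j k X := by
    rw [moment_rightCreat, moment_rightAnnih _ _ hX]; simp
  have e5 : moment j k (leftAnnih (rightCreat X)) = moment (j + 1) (k + 1) X := by
    rw [moment_leftAnnih, moment_rightCreat]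
  have e6 : moment j k (leftCreat (rightAnnih X)) = moment (j + 1) (k + 1) X
      + (j + 1) * moment j k X + k * (moment j k X + j * moment (j - 1) (k - 1) X) := by
    rw [moment_leftCreat _ _ hc, moment_rightAnnih _ _ hX, moment_rightAnnih _ _ hX]
    rcases k with _ | k <;> simp
  simp only [lindbladEnd, LinearMap.add_apply, LinearMap.smul_apply,
    LinearMap.sub_apply, LinearMap.comp_apply]
  have h12 := rapid.smul_mem (1 / 2 : ℂ) (rapid.add_mem h1 h2)
  have h34 := rapid.smul_mem (1 / 2 : ℂ) (rapid.add_mem h3 h4)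
  rw [moment_add _ _ (rapid.add_mem (rapid.smul_mem _ (rapid.sub_mem h1 h2))
      (rapid.smul_mem _ (rapid.sub_mem h5 h12))) (rapid.smul_mem _ (rapid.sub_mem h6 h34)),
    moment_add _ _ (rapid.smul_mem _ (rapid.sub_mem h1 h2))
      (rapid.smul_mem _ (rapid.sub_mem h5 h12)), moment_smul, moment_smul, moment_smul,
    moment_sub _ _ h1 h2, moment_sub _ _ h5 h12, moment_sub _ _ h6 h34, moment_smul, moment_smul,
    moment_add _ _ h1 h2, moment_add _ _ h3 h4, e1, e2, e3, e4, e5, e6, rate]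
  push_cast
  ring

theorem tr_lindbladEnd (γ Δ nth : ℝ) {X : Matrix ℕ ℕ ℂ} (hX : X ∈ rapid) :
    tr (lindbladEnd γ Δ nth X) = 0 := by
  simpa [rate, moment] using moment_lindbladEnd γ Δ nth 0 0 hX

/-! ### The thermal state -/

theorem ratio_nonneg {nth : ℝ} (hn : 0 ≤ nth) : 0 ≤ nth / (1 + nth) := by positivity

theorem ratio_lt_one {nth : ℝ} (hn : 0 ≤ nth) : nth / (1 + nth) < 1 := by
  rw [div_lt_one (by linarith)]; linarith

theorem thermal_mem_rapid {nth : ℝ} (hn : 0 ≤ nth) : thermal nth ∈ rapid := by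
  intro k
  set r := nth / (1 + nth) with hr
  have hr0 : 0 ≤ r := ratio_nonneg hn
  have hr1 : r < 1 := ratio_lt_one hn
  set Z := ∑' k : ℕ, r ^ k with hZ
  have hZ0 : 0 ≤ Z := tsum_nonneg fun k => pow_nonneg hr0 k
  have hs := summable_pow_mul_geometric_of_norm_lt_one k (r := r)
    (by rwa [Real.norm_of_nonneg hr0])
  set C := ∑' n : ℕ, (n : ℝ) ^ k * r ^ n
  have hC0 : 0 ≤ C := tsum_nonneg fun n => by positivity
  refine ⟨3 ^ k * (1 + C) / Z, fun m n => ?_⟩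
  rcases eq_or_ne m n with h | h
  · subst h
    rw [thermal, Matrix.diagonal_apply_eq, Complex.norm_real, ← hr, ← hZ,
      Real.norm_of_nonneg (by positivity), ← mul_div_assoc]
    refine div_le_div_of_nonneg_right ?_ hZ0
    have h1 : (m : ℝ) ^ k * r ^ m ≤ C := hs.le_tsum m fun _ _ => by positivity
    have h2 : r ^ m ≤ 1 := pow_le_one₀ hr0 hr1.le
    -- For `m ≥ 1` one has `1 + 2m ≤ 3m`; the summand `1` on the right is there for `m = 0`.
    have h3 : (1 + (m : ℝ) + m) ^ k ≤ 3 ^ k * (1 + (m : ℝ) ^ k) := by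
      rcases m with _ | m
      · simp only [Nat.cast_zero, add_zero, one_pow]
        have : (1 : ℝ) ≤ 3 ^ k := one_le_pow₀ (by norm_num)
        have h0 : (0 : ℝ) ≤ 0 ^ k := by positivity
        nlinarith
      · calc (1 + ((m + 1 : ℕ) : ℝ) + ((m + 1 : ℕ) : ℝ)) ^ k ≤ (3 * ((m + 1 : ℕ) : ℝ)) ^ k := by
              gcongr; push_cast; linarith [(Nat.cast_nonneg m : (0 : ℝ) ≤ m)]
          _ ≤ _ := by rw [mul_pow]; gcongr; linarith
    calc (1 + (m : ℝ) + m) ^ k * r ^ m ≤ 3 ^ k * (1 + (m : ℝ) ^ k) * r ^ m := by gcongr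
      _ = 3 ^ k * (r ^ m + (m : ℝ) ^ k * r ^ m) := by ring
      _ ≤ _ := by gcongr
  · rw [thermal, Matrix.diagonal_apply_ne _ h]
    simp only [norm_zero, mul_zero]
    positivity

theorem tr_thermal {nth : ℝ} (hn : 0 ≤ nth) : tr (thermal nth) = 1 := by
  have hr0 := ratio_nonneg hn
  have hr1 := ratio_lt_one hn
  simp only [tr, thermal, Matrix.diagonal_apply_eq]
  rw [← Complex.ofReal_tsum, tsum_div_const, tsum_geometric_of_lt_one hr0 hr1, div_self,
    Complex.ofReal_one]
  exact inv_ne_zero (by linarith)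

theorem thermal_apply (nth : ℝ) (m n : ℕ) : thermal nth m n = if m = n then
    (((nth / (1 + nth)) ^ m / ∑' k : ℕ, (nth / (1 + nth)) ^ k : ℝ) : ℂ) else 0 := rfl

/-- Consecutive thermal weights have ratio `r`, so `a` passes through the thermal state at the cost
of a factor `r`. This is what closes the span of the `a†^j ρ a^k` under left multiplication by `a`.
-/
theorem leftAnnih_thermal (nth : ℝ) :
    leftAnnih (thermal nth) = ((nth / (1 + nth) : ℝ) : ℂ) • rightAnnih (thermal nth) := by
  ext m n
  rw [Matrix.smul_apply, leftAnnih_apply, rightAnnih_apply, thermal_apply, thermal_apply]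
  rcases n with _ | n
  · simp
  · rcases eq_or_ne m n with h | h
    · subst h
      simp only [if_true, Nat.add_sub_cancel]
      push_cast
      rw [smul_eq_mul]
      ring
    · simp [h]

theorem rightCreat_thermal (nth : ℝ) :
    rightCreat (thermal nth) = ((nth / (1 + nth) : ℝ) : ℂ) • leftCreat (thermal nth) := by
  ext m n
  rw [Matrix.smul_apply, rightCreat_apply, leftCreat_apply, thermal_apply, thermal_apply]
  rcases m with _ | m
  · simp
  · rcases eq_or_ne m n with h | h
    · subst h
      simp only [if_true, Nat.add_sub_cancel]
      push_cast
      rw [smul_eq_mul]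
      ring
    · simp [h]

/-! ### Polynomials in the ladder operators times the thermal state -/

/-- The operator `a†^j ρ a^k`, where `ρ` is the thermal state. -/
def ladder (nth : ℝ) (j k : ℕ) : Matrix ℕ ℕ ℂ := (leftCreat ^ j) ((rightAnnih ^ k) (thermal nth))

theorem leftCreat_ladder (nth : ℝ) (j k : ℕ) :
    leftCreat (ladder nth j k) = ladder nth (j + 1) k := by
  rw [ladder, ladder, pow_succ']; rfl

theorem rightAnnih_ladder (nth : ℝ) (j k : ℕ) :
    rightAnnih (ladder nth j k) = ladder nth j (k + 1) := by
  have hc : Commute leftCreat rightAnnih := LinearMap.ext leftCreat_rightAnnih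
  have h := LinearMap.congr_fun ((hc.pow_left j).eq) ((rightAnnih ^ k) (thermal nth))
  simp only [Module.End.mul_apply] at h
  rw [ladder, ladder, pow_succ', Module.End.mul_apply, h]

theorem leftAnnih_ladder (nth : ℝ) (j k : ℕ) :
    leftAnnih (ladder nth j k)
      = (j : ℂ) • ladder nth (j - 1) k
        + ((nth / (1 + nth) : ℝ) : ℂ) • ladder nth j (k + 1) := by
  induction j with
  | zero =>
    induction k with
    | zero => simp [ladder, leftAnnih_thermal]
    | succ k ih => rw [← rightAnnih_ladder, leftAnnih_rightAnnih, ih]; simp [rightAnnih_ladder]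
  | succ j ih =>
    rw [← leftCreat_ladder, leftAnnih_leftCreat_eq, ih, map_add, map_smul, map_smul,
      leftCreat_ladder, leftCreat_ladder, Nat.add_sub_cancel]
    rcases j with _ | j
    · simp [add_comm]
    · rw [Nat.add_sub_cancel]
      push_cast
      module

theorem rightCreat_ladder (nth : ℝ) (j k : ℕ) :
    rightCreat (ladder nth j k)
      = (k : ℂ) • ladder nth j (k - 1)
        + ((nth / (1 + nth) : ℝ) : ℂ) • ladder nth (j + 1) k := by
  induction k with
  | zero =>
    induction j with
    | zero => simp [ladder, rightCreat_thermal]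
    | succ j ih => rw [← leftCreat_ladder, ← leftCreat_rightCreat, ih]; simp [leftCreat_ladder]
  | succ k ih =>
    rw [← rightAnnih_ladder, rightCreat_rightAnnih_eq, ih, map_add, map_smul, map_smul,
      rightAnnih_ladder, rightAnnih_ladder, Nat.add_sub_cancel]
    rcases k with _ | k
    · simp [add_comm]
    · rw [Nat.add_sub_cancel]
      push_cast
      module

/-- The terms raising both indices cancel because `(1 + nth) r = nth`, which is detailed balance.
The arguments of `rate` are swapped because its indices count `a†` and `a` in an observable, whereas
here they count them in a state. -/
theorem lindbladEnd_ladder (γ Δ : ℝ) {nth : ℝ} (hn : 0 ≤ nth) (j k : ℕ) :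
    lindbladEnd γ Δ nth (ladder nth j k)
      = rate γ Δ k j • ladder nth j k
        + ((γ : ℂ) * (1 + nth) * j * k) • ladder nth (j - 1) (k - 1) := by
  have hr : (1 + (nth : ℂ)) * ((nth / (1 + nth) : ℝ) : ℂ) = nth := by
    have : (1 + (nth : ℂ)) ≠ 0 := by exact_mod_cast (by linarith : 1 + nth ≠ 0)
    push_cast
    field_simp
  set r : ℂ := ((nth / (1 + nth) : ℝ) : ℂ) with hr'
  have e1 : leftCreat (leftAnnih (ladder nth j k))
      = (j : ℂ) • ladder nth j k + r • ladder nth (j + 1) (k + 1) := by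
    rw [leftAnnih_ladder, map_add, map_smul, map_smul, leftCreat_ladder, leftCreat_ladder]
    rcases j with _ | j <;> simp [hr']
  have e2 : rightAnnih (rightCreat (ladder nth j k))
      = (k : ℂ) • ladder nth j k + r • ladder nth (j + 1) (k + 1) := by
    rw [rightCreat_ladder, map_add, map_smul, map_smul, rightAnnih_ladder, rightAnnih_ladder]
    rcases k with _ | k <;> simp [hr']
  have e3 : leftAnnih (rightCreat (ladder nth j k))
      = (k : ℂ) • ((j : ℂ) • ladder nth (j - 1) (k - 1) + r • ladder nth j k)
        + r • ((j + 1 : ℂ) • ladder nth j k + r • ladder nth (j + 1) (k + 1)) := by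
    rw [rightCreat_ladder, map_add, map_smul, map_smul, leftAnnih_ladder, leftAnnih_ladder]
    rcases k with _ | k <;> simp [hr']
  have e4 : leftCreat (rightAnnih (ladder nth j k)) = ladder nth (j + 1) (k + 1) := by
    rw [rightAnnih_ladder, leftCreat_ladder]
  simp only [lindbladEnd, LinearMap.add_apply, LinearMap.smul_apply, LinearMap.sub_apply,
    LinearMap.comp_apply, leftAnnih_leftCreat_eq, rightCreat_rightAnnih_eq, e1, e2, e3, e4, rate]
  match_scalars
  · linear_combination ((γ : ℂ) * (j + k + 1)) * hr
  · linear_combination ((γ : ℂ) * (r - 1)) * hr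
  · ring

theorem lindbladEnd_thermal (γ Δ : ℝ) {nth : ℝ} (hn : 0 ≤ nth) :
    lindbladEnd γ Δ nth (thermal nth) = 0 := by
  simpa [ladder, rate] using lindbladEnd_ladder γ Δ hn 0 0

/-- The operators `p(a†, a) ρ`, with a polynomial `p`, in the order `a†^j ρ a^k`. -/
def ladderSpan (nth : ℝ) : Submodule ℂ (Matrix ℕ ℕ ℂ) :=
  Submodule.span ℂ (Set.range fun p : ℕ × ℕ => ladder nth p.1 p.2)

theorem ladder_mem (nth : ℝ) (j k : ℕ) : ladder nth j k ∈ ladderSpan nth :=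
  Submodule.subset_span ⟨(j, k), rfl⟩

theorem map_mem_ladderSpan {nth : ℝ} {f : Module.End ℂ (Matrix ℕ ℕ ℂ)}
    (hf : ∀ j k, f (ladder nth j k) ∈ ladderSpan nth) :
    ∀ X ∈ ladderSpan nth, f X ∈ ladderSpan nth := by
  intro X hX
  have h : ladderSpan nth ≤ (ladderSpan nth).comap f :=
    Submodule.span_le.2 (by rintro _ ⟨p, rfl⟩; exact hf p.1 p.2)
  exact h hX

theorem leftCreat_mem_ladderSpan {nth : ℝ} : ∀ X ∈ ladderSpan nth, leftCreat X ∈ ladderSpan nth :=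
  map_mem_ladderSpan fun j k => by rw [leftCreat_ladder]; exact ladder_mem _ _ _

theorem rightAnnih_mem_ladderSpan {nth : ℝ} :
    ∀ X ∈ ladderSpan nth, rightAnnih X ∈ ladderSpan nth :=
  map_mem_ladderSpan fun j k => by rw [rightAnnih_ladder]; exact ladder_mem _ _ _

theorem leftAnnih_mem_ladderSpan {nth : ℝ} : ∀ X ∈ ladderSpan nth, leftAnnih X ∈ ladderSpan nth :=
  map_mem_ladderSpan fun j k => by
    rw [leftAnnih_ladder]
    exact add_mem (Submodule.smul_mem _ _ (ladder_mem _ _ _))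
      (Submodule.smul_mem _ _ (ladder_mem _ _ _))

theorem rightCreat_mem_ladderSpan {nth : ℝ} :
    ∀ X ∈ ladderSpan nth, rightCreat X ∈ ladderSpan nth :=
  map_mem_ladderSpan fun j k => by
    rw [rightCreat_ladder]
    exact add_mem (Submodule.smul_mem _ _ (ladder_mem _ _ _))
      (Submodule.smul_mem _ _ (ladder_mem _ _ _))

theorem lindbladEnd_mem_ladderSpan (γ Δ : ℝ) {nth : ℝ} (hn : 0 ≤ nth) :
    ∀ X ∈ ladderSpan nth, lindbladEnd γ Δ nth X ∈ ladderSpan nth :=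
  map_mem_ladderSpan fun j k => by
    rw [lindbladEnd_ladder γ Δ hn]
    exact add_mem (Submodule.smul_mem _ _ (ladder_mem _ _ _))
      (Submodule.smul_mem _ _ (ladder_mem _ _ _))

theorem thermal_mem_ladderSpan (nth : ℝ) : thermal nth ∈ ladderSpan nth := ladder_mem nth 0 0

theorem ladderSpan_le_rapid {nth : ℝ} (hn : 0 ≤ nth) : ladderSpan nth ≤ rapid := by
  refine Submodule.span_le.2 ?_
  rintro _ ⟨p, rfl⟩
  exact pow_mem_rapid (fun _ => leftCreat_mem_rapid) _
    (pow_mem_rapid (fun _ => rightAnnih_mem_rapid) _ (thermal_mem_rapid hn))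

/-- Back substitution in the triangular action: divide by the nonzero rate and remove the lower term
by induction. The multiple of the thermal state records the obstruction met at `(0, 0)`. -/
theorem exists_lindbladEnd_ladder {γ : ℝ} (hγ : 0 < γ) (Δ : ℝ) {nth : ℝ} (hn : 0 ≤ nth)
    (j k : ℕ) : ∃ X ∈ ladderSpan nth, ∃ c : ℂ,
      lindbladEnd γ Δ nth X + c • thermal nth = ladder nth j k := by
  induction j generalizing k with
  | zero =>
    rcases k with _ | k
    · exact ⟨0, zero_mem _, 1, by simp [ladder]⟩
    · have h := rate_ne_zero hγ Δ (j := k + 1) (k := 0) (by omega)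
      refine ⟨(rate γ Δ (k + 1) 0)⁻¹ • ladder nth 0 (k + 1),
        Submodule.smul_mem _ _ (ladder_mem _ _ _), 0, ?_⟩
      rw [map_smul, lindbladEnd_ladder γ Δ hn]
      simp [smul_smul, inv_mul_cancel₀ h]
  | succ j ih =>
    have h := rate_ne_zero hγ Δ (j := k) (k := j + 1) (by omega)
    -- For `k = 0` this is a junk choice, multiplied below by `d = 0`.
    obtain ⟨X, hX, c, hc⟩ := ih (k - 1)
    set d : ℂ := (γ : ℂ) * (1 + nth) * ((j + 1 : ℕ) : ℂ) * k with hd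
    refine ⟨(rate γ Δ k (j + 1))⁻¹ • (ladder nth (j + 1) k - d • X), Submodule.smul_mem _ _
      (sub_mem (ladder_mem _ _ _) (Submodule.smul_mem _ _ hX)),
      -(rate γ Δ k (j + 1))⁻¹ * d * c, ?_⟩
    rw [map_smul, map_sub, map_smul, lindbladEnd_ladder γ Δ hn, eq_sub_of_add_eq hc, ← hd,
      Nat.add_sub_cancel]
    match_scalars
    · field_simp
    · ring
    · ring

theorem exists_lindbladEnd {γ : ℝ} (hγ : 0 < γ) (Δ : ℝ) {nth : ℝ} (hn : 0 ≤ nth)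
    {R : Matrix ℕ ℕ ℂ} (hR : R ∈ ladderSpan nth) :
    ∃ X ∈ ladderSpan nth, ∃ c : ℂ, lindbladEnd γ Δ nth X + c • thermal nth = R := by
  induction hR using Submodule.span_induction with
  | mem R h => obtain ⟨p, rfl⟩ := h; exact exists_lindbladEnd_ladder hγ Δ hn _ _
  | zero => exact ⟨0, zero_mem _, 0, by simp⟩
  | add R R' _ _ h h' =>
    obtain ⟨X, hX, c, rfl⟩ := h
    obtain ⟨X', hX', c', rfl⟩ := h'
    exact ⟨X + X', add_mem hX hX', c + c', by rw [map_add]; module⟩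
  | smul a R _ h =>
    obtain ⟨X, hX, c, rfl⟩ := h
    exact ⟨a • X, Submodule.smul_mem _ _ hX, a * c, by rw [map_smul]; module⟩

/-! ### Qubit blocks of operators on the composite system -/

/-- The block `⟨i| X |j⟩`, an operator on the oscillator. -/
def block (i j : Fin 2) : OpAB →ₗ[ℂ] Matrix ℕ ℕ ℂ where
  toFun X := fun m n => X (m, i) (n, j)
  map_add' _ _ := rfl
  map_smul' _ _ := rfl

theorem block_apply (i j : Fin 2) (X : OpAB) (m n : ℕ) : block i j X m n = X (m, i) (n, j) := rfl

theorem ext_block {X Y : OpAB} (h : ∀ i j, block i j X = block i j Y) : X = Y := by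
  ext ⟨m, i⟩ ⟨n, j⟩
  exact congrFun (congrFun (h i j) m) n

theorem block_onA (i j : Fin 2) (S : Matrix ℕ ℕ ℂ → Matrix ℕ ℕ ℂ) (X : OpAB) :
    block i j (onA S X) = S (block i j X) := rfl

theorem block_kronecker (i j : Fin 2) (A : Matrix ℕ ℕ ℂ) (ρ : OpB) :
    block i j (A ⊗ₖ ρ) = ρ i j • A := by
  ext m n
  simp [block_apply, mul_comm]

theorem rapidDecay_iff {X : OpAB} : RapidDecay X ↔ ∀ i j, block i j X ∈ rapid := by
  constructor
  · intro h i j k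
    obtain ⟨C, hC⟩ := h k
    exact ⟨C, fun m n => hC (m, i) (n, j)⟩
  · intro h k
    choose C hC using fun i j => h i j k
    refine ⟨∑ i, ∑ j, C i j, fun x y => (hC x.2 y.2 x.1 y.1).trans ?_⟩
    have h0 : ∀ i j, 0 ≤ C i j := fun i j => le_trans (by positivity) (hC i j 0 0)
    exact (Finset.single_le_sum (f := C x.2) (fun j _ => h0 _ j) (Finset.mem_univ y.2)).trans
      (Finset.single_le_sum (f := fun i => ∑ j, C i j)
        (fun i _ => Finset.sum_nonneg fun j _ => h0 i j) (Finset.mem_univ x.2))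

theorem sigmaPlus_eq : sigmaPlus = !![0, 1; 0, 0] := by
  ext i j
  fin_cases i <;> fin_cases j <;> (simp [sigmaPlus, sigmaX, sigmaY]; try norm_num)

theorem sigmaMinus_eq : sigmaMinus = !![0, 0; 1, 0] := by
  ext i j
  fin_cases i <;> fin_cases j <;> (simp [sigmaMinus, sigmaX, sigmaY]; try norm_num)

/-- The interaction Hamiltonian divided by the coupling constant. -/
def hamInt : OpAB := creat ⊗ₖ sigmaMinus + annih ⊗ₖ sigmaPlus

theorem hamInt_apply (x y : ℕ × Fin 2) :
    hamInt x y = creat x.1 y.1 * sigmaMinus x.2 y.2 + annih x.1 y.1 * sigmaPlus x.2 y.2 := rfl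

theorem hamInt_zero_zero (m n : ℕ) : hamInt (m, 0) (n, 0) = 0 := by
  simp [hamInt_apply, sigmaPlus_eq, sigmaMinus_eq]

theorem hamInt_zero_one (m n : ℕ) : hamInt (m, 0) (n, 1) = annih m n := by
  simp [hamInt_apply, sigmaPlus_eq, sigmaMinus_eq]

theorem hamInt_one_zero (m n : ℕ) : hamInt (m, 1) (n, 0) = creat m n := by
  simp [hamInt_apply, sigmaPlus_eq, sigmaMinus_eq]

theorem hamInt_one_one (m n : ℕ) : hamInt (m, 1) (n, 1) = 0 := by
  simp [hamInt_apply, sigmaPlus_eq, sigmaMinus_eq]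

/-- With index `0` for the upper qubit state, the interaction is the block matrix with off-diagonal
entries `a`, `a†`. Each block of a product is thus a single ladder operator applied to one block. -/
theorem block_zero_hamInt_mul (j : Fin 2) (X : OpAB) :
    block 0 j (opMul hamInt X) = leftAnnih (block 1 j X) := by
  ext m n
  rw [block_apply, opMul, tsum_eq_single (m + 1, 1)]
  · simp [hamInt_zero_one, annih_apply, leftAnnih_apply, block_apply]
  · rintro ⟨k, l⟩ h
    fin_cases l
    · simp [hamInt_zero_zero]
    · have hk : k ≠ m + 1 := by rintro rfl; exact h rfl
      simp [hamInt_zero_one, annih_apply, hk]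

theorem block_one_hamInt_mul (j : Fin 2) (X : OpAB) :
    block 1 j (opMul hamInt X) = leftCreat (block 0 j X) := by
  ext m n
  rw [block_apply, opMul, tsum_eq_single (m - 1, 0)]
  · rcases m with _ | m <;>
      simp [hamInt_one_zero, creat_apply, leftCreat_apply, block_apply]
  · rintro ⟨k, l⟩ h
    fin_cases l
    · have hk : ¬ m = k + 1 := by rintro rfl; exact h rfl
      simp [hamInt_one_zero, creat_apply, hk]
    · simp [hamInt_one_one]

theorem block_zero_mul_hamInt (i : Fin 2) (X : OpAB) :
    block i 0 (opMul X hamInt) = rightCreat (block i 1 X) := by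
  ext m n
  rw [block_apply, opMul, tsum_eq_single (n + 1, 1)]
  · simp [hamInt_one_zero, creat_apply, rightCreat_apply, block_apply, mul_comm]
  · rintro ⟨k, l⟩ h
    fin_cases l
    · simp [hamInt_zero_zero]
    · have hk : k ≠ n + 1 := by rintro rfl; exact h rfl
      simp [hamInt_one_zero, creat_apply, hk]

theorem block_one_mul_hamInt (i : Fin 2) (X : OpAB) :
    block i 1 (opMul X hamInt) = rightAnnih (block i 0 X) := by
  ext m n
  rw [block_apply, opMul, tsum_eq_single (n - 1, 0)]
  · rcases n with _ | n <;>
      simp [hamInt_zero_one, annih_apply, rightAnnih_apply, block_apply, mul_comm]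
  · rintro ⟨k, l⟩ h
    fin_cases l
    · have hk : ¬ n = k + 1 := by rintro rfl; exact h rfl
      simp [hamInt_zero_one, annih_apply, hk]
    · simp [hamInt_one_one]

theorem block_comm_zero_zero (X : OpAB) : block 0 0 (comm hamInt X)
    = leftAnnih (block 1 0 X) - rightCreat (block 0 1 X) := by
  rw [comm, map_sub, block_zero_hamInt_mul, block_zero_mul_hamInt]

theorem block_comm_zero_one (X : OpAB) : block 0 1 (comm hamInt X)
    = leftAnnih (block 1 1 X) - rightAnnih (block 0 0 X) := by
  rw [comm, map_sub, block_zero_hamInt_mul, block_one_mul_hamInt]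

theorem block_comm_one_zero (X : OpAB) : block 1 0 (comm hamInt X)
    = leftCreat (block 0 0 X) - rightCreat (block 1 1 X) := by
  rw [comm, map_sub, block_one_hamInt_mul, block_zero_mul_hamInt]

theorem block_comm_one_one (X : OpAB) : block 1 1 (comm hamInt X)
    = leftCreat (block 0 1 X) - rightAnnih (block 1 0 X) := by
  rw [comm, map_sub, block_one_hamInt_mul, block_one_mul_hamInt]

/-- The prefactor of the interaction superoperator. -/
def coupling (g γ : ℝ) : ℂ := -Complex.I * ((g / epsilon g γ : ℝ) : ℂ)

theorem lindbladInt_eq (g γ : ℝ) (X : OpAB) :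
    lindbladInt g γ X = coupling g γ • comm hamInt X := rfl

theorem epsilon_mul_coupling (g : ℝ) {γ : ℝ} (hγ : 0 < γ) :
    ((epsilon g γ : ℝ) : ℂ) * coupling g γ = -Complex.I * g := by
  rw [coupling, mul_left_comm, ← Complex.ofReal_mul]
  rcases eq_or_ne g 0 with rfl | hg
  · simp
  · rw [mul_div_cancel₀]
    exact div_ne_zero (abs_ne_zero.2 hg) hγ.ne'

/-! ### Existence of the expansion -/

/-- The algebraic recursion behind adiabatic elimination: a generalised inverse of the fast
generator yields all orders of the expansion. -/
theorem exists_recursive_expansion {B X : Type*} [AddCommGroup B] [Module ℂ B] [AddCommGroup X]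
    [Module ℂ X] (θ : B →ₗ[ℂ] X) (τ : X →ₗ[ℂ] B) (Λ S J : X →ₗ[ℂ] X) (hθ : τ ∘ₗ θ = LinearMap.id)
    (hS : ∀ x, Λ (S x) = x - θ (τ x)) (hτ : ∀ x, τ (S x) = 0) :
    ∃ (K : ℕ → B →ₗ[ℂ] X) (L : ℕ → B →ₗ[ℂ] B), K 0 = θ ∧ L 0 = 0 ∧
      (∀ n b, τ (K (n + 1) b) = 0) ∧
      ∀ n b, ∑ k ∈ Finset.range (n + 2), K k (L (n + 1 - k) b) = Λ (K (n + 1) b) + J (K n b) := by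
  -- Applying `τ` suggests `L (n+1) = τ ∘ J ∘ K n`. With this substituted, `K (n+1)` is `S` applied
  -- to the remaining terms, all of which involve only earlier `K`; hence a strong recursion.
  let step : (n : ℕ) → ((m : ℕ) → m < n → B →ₗ[ℂ] X) → B →ₗ[ℂ] X := fun n =>
    match n with
    | 0 => fun _ => θ
    | n + 1 => fun f => S ∘ₗ (∑ k : Fin (n + 1),
        f k k.2 ∘ₗ τ ∘ₗ J ∘ₗ f (n - k) (by omega) - J ∘ₗ f n (by omega))
  let K : ℕ → B →ₗ[ℂ] X := Nat.lt_wfRel.wf.fix step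
  have hK : ∀ n, K n = step n fun m _ => K m := Nat.lt_wfRel.wf.fix_eq step
  have hK0 : K 0 = θ := hK 0
  have hK1 : ∀ n, K (n + 1) = S ∘ₗ (∑ k ∈ Finset.range (n + 1),
      K k ∘ₗ τ ∘ₗ J ∘ₗ K (n - k) - J ∘ₗ K n) := fun n => by
    rw [Finset.sum_range, hK]
  let L : ℕ → B →ₗ[ℂ] B := fun n => match n with
    | 0 => 0
    | n + 1 => τ ∘ₗ J ∘ₗ K n
  have hτK : ∀ n b, τ (K (n + 1) b) = 0 := fun n b => by rw [hK1, LinearMap.comp_apply, hτ]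
  refine ⟨K, L, hK0, rfl, hτK, fun n b => ?_⟩
  have hL0 : L 0 = 0 := rfl
  have hL : ∀ k ∈ Finset.range (n + 1), K k (L (n + 1 - k) b) = K k (τ (J (K (n - k) b))) := by
    intro k hk
    rw [Nat.succ_sub (Nat.lt_succ_iff.1 (Finset.mem_range.1 hk))]
    rfl
  -- Solvability: under `τ` only the term `k = 0` survives, so the argument of `S` is killed by `τ`
  -- and `Λ ∘ S` acts on it as the identity.
  have hsum : τ (∑ k ∈ Finset.range (n + 1), K k (τ (J (K (n - k) b)))) = τ (J (K n b)) := by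
    rw [Finset.sum_range_succ', map_add, map_sum, Finset.sum_eq_zero fun k _ => hτK _ _, zero_add,
      hK0]
    exact LinearMap.congr_fun hθ _
  rw [Finset.sum_range_succ, Nat.sub_self, hL0, LinearMap.zero_apply, map_zero, add_zero,
    Finset.sum_congr rfl hL, hK1, LinearMap.comp_apply, hS]
  simp only [LinearMap.sub_apply, LinearMap.sum_apply, LinearMap.comp_apply, map_sub, hsum,
    sub_self, map_zero, sub_zero, sub_add_cancel]

/-- The trace on operators of the form `p(a†, a) ρ`. -/
def trSpan {nth : ℝ} (hn : 0 ≤ nth) : ladderSpan nth →ₗ[ℂ] ℂ where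
  toFun X := tr X
  map_add' X Y := tr_add (ladderSpan_le_rapid hn X.2) (ladderSpan_le_rapid hn Y.2)
  map_smul' c X := tr_smul c X

/-- Adding the rank-one map `X ↦ tr X • ρ` makes the generator surjective. A linear right inverse of
the sum preserves the trace, because the generator has traceless image; subtracting `tr R • ρ` from
it makes its values traceless. -/
theorem exists_generalised_inverse {γ : ℝ} (hγ : 0 < γ) (Δ : ℝ) {nth : ℝ} (hn : 0 ≤ nth) :
    ∃ S : ladderSpan nth →ₗ[ℂ] ladderSpan nth, ∀ R, tr (S R : Matrix ℕ ℕ ℂ) = 0 ∧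
      lindbladEnd γ Δ nth (S R) = R - tr (R : Matrix ℕ ℕ ℂ) • thermal nth := by
  let th : ladderSpan nth := ⟨thermal nth, thermal_mem_ladderSpan nth⟩
  let Λ : ladderSpan nth →ₗ[ℂ] ladderSpan nth :=
    (lindbladEnd γ Δ nth).restrict (lindbladEnd_mem_ladderSpan γ Δ hn)
  let Ψ : ladderSpan nth →ₗ[ℂ] ladderSpan nth := Λ + (trSpan hn).smulRight th
  have hΨ : Function.Surjective Ψ := by
    rintro ⟨R, hR⟩
    obtain ⟨X, hX, c, hc⟩ := exists_lindbladEnd hγ Δ hn hR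
    have hX' := ladderSpan_le_rapid hn hX
    have hth := thermal_mem_rapid hn
    -- The generator ignores the thermal component, which is free to adjust the trace to `c`.
    refine ⟨⟨X + (c - tr X) • thermal nth, add_mem hX (Submodule.smul_mem _ _ th.2)⟩,
      Subtype.ext ?_⟩
    change lindbladEnd γ Δ nth (X + (c - tr X) • thermal nth)
      + tr (X + (c - tr X) • thermal nth) • thermal nth = R
    rw [tr_add hX' (rapid.smul_mem _ hth), tr_smul, tr_thermal hn, map_add, map_smul,
      lindbladEnd_thermal γ Δ hn, ← hc]
    module
  obtain ⟨T, hT⟩ := LinearMap.exists_rightInverse_of_surjective Ψ (LinearMap.range_eq_top.2 hΨ)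
  refine ⟨T - (trSpan hn).smulRight th, fun R => ?_⟩
  have hR : lindbladEnd γ Δ nth (T R) + tr (T R : Matrix ℕ ℕ ℂ) • thermal nth = R :=
    congrArg Subtype.val (LinearMap.congr_fun hT R)
  have hTR := ladderSpan_le_rapid hn (T R).2
  have hth := thermal_mem_rapid hn
  have htr : tr (T R : Matrix ℕ ℕ ℂ) = tr (R : Matrix ℕ ℕ ℂ) := by
    have := congrArg tr hR
    rwa [tr_add (lindbladEnd_mem_rapid γ Δ nth hTR) (rapid.smul_mem _ hth), tr_smul,
      tr_thermal hn, tr_lindbladEnd _ _ _ hTR, zero_add, mul_one] at this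
  have hval : ((T - (trSpan hn).smulRight th) R : ladderSpan nth)
      = (T R : Matrix ℕ ℕ ℂ) + (-tr (R : Matrix ℕ ℕ ℂ)) • thermal nth := by
    change (T R : Matrix ℕ ℕ ℂ) - tr (R : Matrix ℕ ℕ ℂ) • thermal nth = _
    module
  rw [hval]
  constructor
  · rw [tr_add hTR (rapid.smul_mem _ hth), tr_smul, tr_thermal hn, htr]; ring
  · rw [map_add, map_smul, lindbladEnd_thermal γ Δ hn, smul_zero, add_zero, ← htr]
    exact eq_sub_of_add_eq hR

/-- Operators on the composite system with a given matrix of blocks. -/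
def ofBlocks (nth : ℝ) : (Fin 2 → Fin 2 → ladderSpan nth) →ₗ[ℂ] OpAB where
  toFun F := fun x y => (F x.2 y.2 : Matrix ℕ ℕ ℂ) x.1 y.1
  map_add' _ _ := rfl
  map_smul' _ _ := rfl

theorem block_ofBlocks (nth : ℝ) (F : Fin 2 → Fin 2 → ladderSpan nth) (i j : Fin 2) :
    block i j (ofBlocks nth F) = F i j := rfl

/-- The commutator with the interaction Hamiltonian, in terms of blocks. -/
def commBlocks (nth : ℝ) :
    (Fin 2 → Fin 2 → ladderSpan nth) →ₗ[ℂ] (Fin 2 → Fin 2 → ladderSpan nth) :=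
  let a : ladderSpan nth →ₗ[ℂ] ladderSpan nth := leftAnnih.restrict leftAnnih_mem_ladderSpan
  let c : ladderSpan nth →ₗ[ℂ] ladderSpan nth := leftCreat.restrict leftCreat_mem_ladderSpan
  let a' : ladderSpan nth →ₗ[ℂ] ladderSpan nth := rightAnnih.restrict rightAnnih_mem_ladderSpan
  let c' : ladderSpan nth →ₗ[ℂ] ladderSpan nth := rightCreat.restrict rightCreat_mem_ladderSpan
  let π : Fin 2 → Fin 2 → (Fin 2 → Fin 2 → ladderSpan nth) →ₗ[ℂ] ladderSpan nth := fun i j =>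
    LinearMap.proj j ∘ₗ LinearMap.proj i
  LinearMap.pi
    ![LinearMap.pi ![a ∘ₗ π 1 0 - c' ∘ₗ π 0 1, a ∘ₗ π 1 1 - a' ∘ₗ π 0 0],
      LinearMap.pi ![c ∘ₗ π 0 0 - c' ∘ₗ π 1 1, c ∘ₗ π 0 1 - a' ∘ₗ π 1 0]]

theorem ofBlocks_commBlocks (nth : ℝ) (F : Fin 2 → Fin 2 → ladderSpan nth) :
    ofBlocks nth (commBlocks nth F) = comm hamInt (ofBlocks nth F) := by
  refine ext_block ?_
  rw [Fin.forall_fin_two, Fin.forall_fin_two, Fin.forall_fin_two, block_comm_zero_zero,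
    block_comm_zero_one, block_comm_one_zero, block_comm_one_one]
  simp only [block_ofBlocks]
  exact ⟨⟨rfl, rfl⟩, rfl, rfl⟩

theorem exists_expansion (g : ℝ) {γ : ℝ} (hγ : 0 < γ) (Δ : ℝ) {nth : ℝ} (hn : 0 ≤ nth) :
    ∃ (K : ℕ → OpB →ₗ[ℂ] OpAB) (L : ℕ → OpB →ₗ[ℂ] OpB), ∀ N : ℕ, IsExpansion g γ Δ nth N K L := by
  obtain ⟨S, hS⟩ := exists_generalised_inverse hγ Δ hn
  let V := ladderSpan nth
  let Λ₀ : V →ₗ[ℂ] V := (lindbladEnd γ Δ nth).restrict (lindbladEnd_mem_ladderSpan γ Δ hn)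
  let th : V := ⟨thermal nth, thermal_mem_ladderSpan nth⟩
  let π : Fin 2 → Fin 2 → (Fin 2 → Fin 2 → V) →ₗ[ℂ] V := fun i j =>
    LinearMap.proj j ∘ₗ LinearMap.proj i
  let θ : OpB →ₗ[ℂ] Fin 2 → Fin 2 → V :=
    { toFun := fun ρ i j => ρ i j • th
      map_add' := fun ρ ρ' => by funext i j; exact add_smul _ _ _
      map_smul' := fun z ρ => by funext i j; exact mul_smul _ _ _ }
  let τ : (Fin 2 → Fin 2 → V) →ₗ[ℂ] OpB :=
    { toFun := fun F i j => trSpan hn (F i j)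
      map_add' := fun F G => by funext i j; exact map_add (trSpan hn) _ _
      map_smul' := fun z F => by funext i j; exact map_smul (trSpan hn) _ _ }
  let blockwise : (V →ₗ[ℂ] V) → (Fin 2 → Fin 2 → V) →ₗ[ℂ] (Fin 2 → Fin 2 → V) := fun f =>
    LinearMap.pi fun i => LinearMap.pi fun j => f ∘ₗ π i j
  let J : (Fin 2 → Fin 2 → V) →ₗ[ℂ] (Fin 2 → Fin 2 → V) := coupling g γ • commBlocks nth
  have hJ : ∀ F, ofBlocks nth (J F) = lindbladInt g γ (ofBlocks nth F) := fun F => by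
    rw [lindbladInt_eq, ← ofBlocks_commBlocks]; rfl
  have hΛ : ∀ F, ofBlocks nth (blockwise Λ₀ F)
      = onA (lindbladA γ Δ nth) (ofBlocks nth F) := fun F => by
    refine ext_block fun i j => ?_
    rw [block_onA, lindbladA_eq]; rfl
  have hθ : ∀ ρ, ofBlocks nth (θ ρ) = thermal nth ⊗ₖ ρ := fun ρ => by
    refine ext_block fun i j => ?_
    rw [block_kronecker]; rfl
  obtain ⟨K, L, hK0, hL0, hτ, hKL⟩ := exists_recursive_expansion θ τ (blockwise Λ₀) (blockwise S) J
    (by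
      refine LinearMap.ext fun ρ => ?_
      funext i j
      change trSpan hn (ρ i j • th) = ρ i j
      rw [map_smul]
      change ρ i j * tr (thermal nth) = _
      rw [tr_thermal hn, mul_one])
    (by
      intro F
      funext i j
      exact Subtype.ext (hS (F i j)).2)
    (by
      intro F
      funext i j
      exact (hS (F i j)).1)
  have hK0' : ∀ ρ, (ofBlocks nth ∘ₗ K 0) ρ = thermal nth ⊗ₖ ρ := fun ρ => by
    rw [LinearMap.comp_apply, hK0, hθ]
  refine ⟨fun n => ofBlocks nth ∘ₗ K n, L, fun N => ⟨hK0', hL0, ?_, ?_, ?_, ?_⟩⟩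
  · exact fun n _ ρ => rapidDecay_iff.2 fun i j => ladderSpan_le_rapid hn (K n ρ i j).2
  · intro n h1 _ ρ
    obtain ⟨n, rfl⟩ := Nat.exists_eq_add_of_le' h1
    exact hτ n ρ
  · intro ρ
    rw [hL0, LinearMap.zero_apply, map_zero, hK0']
    refine ext_block fun i j => ?_
    rw [block_onA, block_kronecker, lindbladA_eq, map_smul, lindbladEnd_thermal γ Δ hn, smul_zero,
      map_zero]
  · intro n _ ρ
    have h := congrArg (ofBlocks nth) (hKL n ρ)
    rw [map_sum, map_add, hΛ, hJ] at h
    exact h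

/-! ### The hierarchy of moments -/

/-- Stationarity turns the moment equations into a recursion along diagonals. Off the main diagonal
it ends at a zero moment; on it the rate is `-γ j`, so each step multiplies by `j nth`. -/
theorem moment_thermal {γ : ℝ} (hγ : 0 < γ) (Δ : ℝ) {nth : ℝ} (hn : 0 ≤ nth) (j k : ℕ) :
    moment j k (thermal nth) = if j = k then (j.factorial : ℂ) * (nth : ℂ) ^ j else 0 := by
  have key : ∀ j k, rate γ Δ j k * moment j k (thermal nth)
      + γ * nth * j * k * moment (j - 1) (k - 1) (thermal nth) = 0 := fun j k => by
    rw [← moment_lindbladEnd γ Δ nth j k (thermal_mem_rapid hn), lindbladEnd_thermal γ Δ hn]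
    simpa using moment_smul j k 0 0
  induction j generalizing k with
  | zero =>
    rcases k with _ | k
    · simp [moment, tr_thermal hn]
    · have h := key 0 (k + 1)
      simpa [rate_ne_zero hγ Δ (show 0 < 0 + (k + 1) by omega)] using h
  | succ j ih =>
    have h := key (j + 1) k
    have hr := rate_ne_zero hγ Δ (show 0 < j + 1 + k by omega)
    rcases k with _ | k
    · simpa [hr] using h
    · rw [Nat.add_sub_cancel, Nat.add_sub_cancel, ih] at h
      rcases eq_or_ne j k with rfl | hjk
      · refine mul_left_cancel₀ hr ?_
        rw [if_pos rfl] at h ⊢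
        rw [eq_neg_of_add_eq_zero_left h, rate, Nat.factorial_succ]
        push_cast
        ring
      · rw [if_neg hjk] at h
        rw [if_neg (by omega)]
        simpa [hr] using h

/-- The qubit operator `tr_A (a^k X a†^j)`. -/
def momentB (j k : ℕ) (X : OpAB) : OpB := Matrix.of fun i l => moment j k (block i l X)

theorem momentB_apply (j k : ℕ) (X : OpAB) (i l : Fin 2) :
    momentB j k X i l = moment j k (block i l X) := rfl

theorem momentB_zero (j k : ℕ) : momentB j k 0 = 0 := by
  ext i l
  simpa [momentB_apply] using moment_smul j k 0 0

theorem momentB_comm (j k : ℕ) {X : OpAB} (hX : RapidDecay X) :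
    momentB j k (comm hamInt X) =
      !![momentB j (k + 1) X 1 0 - momentB (j + 1) k X 0 1,
        momentB j (k + 1) X 1 1 - (momentB j (k + 1) X 0 0 + j * momentB (j - 1) k X 0 0);
        momentB (j + 1) k X 0 0 + k * momentB j (k - 1) X 0 0 - momentB (j + 1) k X 1 1,
        momentB (j + 1) k X 0 1 + k * momentB j (k - 1) X 0 1
          - (momentB j (k + 1) X 1 0 + j * momentB (j - 1) k X 1 0)] := by
  have h := rapidDecay_iff.1 hX
  refine Matrix.ext ?_
  rw [Fin.forall_fin_two, Fin.forall_fin_two, Fin.forall_fin_two]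
  simp only [momentB_apply, block_comm_zero_zero, block_comm_zero_one, block_comm_one_zero,
    block_comm_one_one]
  rw [moment_sub _ _ (leftAnnih_mem_rapid (h 1 0)) (rightCreat_mem_rapid (h 0 1)),
    moment_sub _ _ (leftAnnih_mem_rapid (h 1 1)) (rightAnnih_mem_rapid (h 0 0)),
    moment_sub _ _ (leftCreat_mem_rapid (h 0 0)) (rightCreat_mem_rapid (h 1 1)),
    moment_sub _ _ (leftCreat_mem_rapid (h 0 1)) (rightAnnih_mem_rapid (h 1 0)),
    moment_leftAnnih, moment_leftAnnih, moment_rightCreat, moment_rightCreat,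
    moment_leftCreat _ _ (h 0 0), moment_leftCreat _ _ (h 0 1), moment_rightAnnih _ _ (h 0 0),
    moment_rightAnnih _ _ (h 1 0)]
  simp

theorem comm_mem_rapid {X : OpAB} (hX : RapidDecay X) : RapidDecay (comm hamInt X) := by
  have h := rapidDecay_iff.1 hX
  rw [rapidDecay_iff, Fin.forall_fin_two, Fin.forall_fin_two, Fin.forall_fin_two,
    block_comm_zero_zero, block_comm_zero_one, block_comm_one_zero, block_comm_one_one]
  exact ⟨⟨rapid.sub_mem (leftAnnih_mem_rapid (h _ _)) (rightCreat_mem_rapid (h _ _)),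
    rapid.sub_mem (leftAnnih_mem_rapid (h _ _)) (rightAnnih_mem_rapid (h _ _))⟩,
    rapid.sub_mem (leftCreat_mem_rapid (h _ _)) (rightCreat_mem_rapid (h _ _)),
    rapid.sub_mem (leftCreat_mem_rapid (h _ _)) (rightAnnih_mem_rapid (h _ _))⟩

section Expansion

variable {g γ Δ nth : ℝ} {N : ℕ} {K : ℕ → OpB →ₗ[ℂ] OpAB} {L : ℕ → OpB →ₗ[ℂ] OpB}

theorem IsExpansion.momentB_zero_order (h : IsExpansion g γ Δ nth N K L) (hγ : 0 < γ)
    (hn : 0 ≤ nth) (j k : ℕ) (ρ : OpB) :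
    momentB j k (K 0 ρ) = (if j = k then (j.factorial : ℂ) * (nth : ℂ) ^ j else 0) • ρ := by
  ext i l
  rw [h.K_zero, momentB_apply, block_kronecker, moment_smul, moment_thermal hγ Δ hn,
    Matrix.smul_apply, smul_eq_mul, mul_comm]

/-- The invariance equation tested against `a†^j a^k`. The summand of index `n + 1` drops out since
`L 0 = 0`, so for `j + k > 0` this determines the moment from earlier orders, the reduced generators
and a lower moment. -/
theorem IsExpansion.momentB_succ (h : IsExpansion g γ Δ nth N K L) (n : ℕ) (hN : n + 1 ≤ N)
    (j k : ℕ) (ρ : OpB) :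
    rate γ Δ j k • momentB j k (K (n + 1) ρ)
      = ∑ m ∈ Finset.range (n + 1), momentB j k (K m (L (n + 1 - m) ρ))
        - (γ * nth * j * k : ℂ) • momentB (j - 1) (k - 1) (K (n + 1) ρ)
        - coupling g γ • momentB j k (comm hamInt (K n ρ)) := by
  ext i l
  have hK : ∀ m ∈ Finset.range (n + 2), block i l (K m (L (n + 1 - m) ρ)) ∈ JaynesCummings.rapid := fun m hm =>
    rapidDecay_iff.1 (h.rapid m (by have := Finset.mem_range.1 hm; omega) _) i l
  have hK1 := rapidDecay_iff.1 (h.rapid (n + 1) hN ρ) i l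
  have hC := rapidDecay_iff.1 (comm_mem_rapid (h.rapid n (by omega) ρ)) i l
  have e := congrArg (fun X => moment j k (block i l X)) (h.order_succ n hN ρ)
  simp only [map_sum, map_add, block_onA, lindbladA_eq, lindbladInt_eq, map_smul] at e
  rw [moment_sum _ _ _ _ hK, moment_add _ _ (lindbladEnd_mem_rapid γ Δ nth hK1)
    (Submodule.smul_mem _ _ hC), moment_lindbladEnd γ Δ nth j k hK1, moment_smul,
    Finset.sum_range_succ, Nat.sub_self, h.L_zero, LinearMap.zero_apply, map_zero, map_zero] at e
  have h0 : moment j k (0 : Matrix ℕ ℕ ℂ) = 0 := by simpa using moment_smul j k 0 0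
  simp only [Matrix.sub_apply, Matrix.smul_apply, Matrix.sum_apply, momentB_apply, smul_eq_mul]
  rw [h0] at e
  linear_combination -e

theorem IsExpansion.momentB_zero_zero_succ (h : IsExpansion g γ Δ nth N K L) (n : ℕ)
    (hN : n + 1 ≤ N) (ρ : OpB) : momentB 0 0 (K (n + 1) ρ) = 0 :=
  h.gauge (n + 1) (by omega) hN ρ

/-- At `(0, 0)` the rate vanishes and the gauge condition kills every summand but the one from `K
0`, which is `L (n+1) ρ` itself. -/
theorem IsExpansion.L_succ (h : IsExpansion g γ Δ nth N K L) (hγ : 0 < γ) (hn : 0 ≤ nth) (n : ℕ)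
    (hN : n + 1 ≤ N) (ρ : OpB) :
    L (n + 1) ρ = coupling g γ • momentB 0 0 (comm hamInt (K n ρ)) := by
  have e := h.momentB_succ n hN 0 0 ρ
  rw [h.momentB_zero_zero_succ n hN, Finset.sum_range_succ', Finset.sum_eq_zero fun m hm =>
    h.momentB_zero_zero_succ m (by have := Finset.mem_range.1 hm; omega) _,
    h.momentB_zero_order hγ hn] at e
  simp only [rate, Nat.cast_zero, add_zero, sub_self, mul_zero, zero_smul, if_true,
    Nat.factorial_zero, Nat.cast_one, pow_zero, mul_one, one_smul, zero_add, Nat.sub_zero,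
    sub_zero] at e
  exact sub_eq_zero.1 e.symm

end Expansion

/-! ### The expansion up to order four -/

section Expansion

variable {g γ Δ nth : ℝ} {K : ℕ → OpB →ₗ[ℂ] OpAB} {L : ℕ → OpB →ₗ[ℂ] OpB}

/-- The complex number `γ - 2 i Δ`. -/
def gammaBarConj (γ Δ : ℝ) : ℂ := (γ : ℂ) - 2 * Complex.I * (Δ : ℂ)

theorem gammaBar_ne_zero (hγ : 0 < γ) (Δ : ℝ) : gammaBar γ Δ ≠ 0 := by
  intro h
  have := congrArg Complex.re h
  simp [gammaBar] at this
  exact hγ.ne' this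

theorem gammaBarConj_ne_zero (hγ : 0 < γ) (Δ : ℝ) : gammaBarConj γ Δ ≠ 0 := by
  intro h
  have := congrArg Complex.re h
  simp [gammaBarConj] at this
  exact hγ.ne' this

/-- Eliminating `γ` leaves rational identities in the two independent quantities `γ ± 2iΔ`. -/
theorem gamma_eq (γ Δ : ℝ) : (γ : ℂ) = (gammaBar γ Δ + gammaBarConj γ Δ) / 2 := by
  rw [gammaBar, gammaBarConj]; ring

theorem gammaBar_add_ne_zero (hγ : 0 < γ) (Δ : ℝ) : gammaBar γ Δ + gammaBarConj γ Δ ≠ 0 := by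
  have := gamma_eq γ Δ
  intro h0
  rw [h0, zero_div] at this
  exact hγ.ne' (by exact_mod_cast this)

theorem rate_eq (γ Δ : ℝ) (j k : ℕ) :
    rate γ Δ j k = -(j * gammaBarConj γ Δ + k * gammaBar γ Δ) / 2 := by
  rw [rate, gammaBar, gammaBarConj]; ring

theorem smul_right_injective_OpB {r : ℂ} (hr : r ≠ 0) {A B : OpB} (h : r • A = r • B) : A = B :=
  smul_right_injective OpB hr h

theorem IsExpansion.L_one (h : IsExpansion g γ Δ nth 4 K L) (hγ : 0 < γ) (hn : 0 ≤ nth)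
    (ρ : OpB) : L 1 ρ = 0 := by
  rw [h.L_succ hγ hn 0 (by norm_num), momentB_comm _ _ (h.rapid 0 (by norm_num) ρ)]
  simp only [h.momentB_zero_order hγ hn]
  ext i l
  fin_cases i <;> fin_cases l <;> simp

theorem IsExpansion.momentB_one (h : IsExpansion g γ Δ nth 4 K L) (hγ : 0 < γ) (hn : 0 ≤ nth)
    (j k : ℕ) (ρ : OpB) :
    rate γ Δ j k • momentB j k (K 1 ρ)
      = -(γ * nth * j * k : ℂ) • momentB (j - 1) (k - 1) (K 1 ρ)
        - coupling g γ • momentB j k (comm hamInt (K 0 ρ)) := by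
  rw [h.momentB_succ 0 (by norm_num)]
  simp [h.L_one hγ hn, momentB_zero]

theorem IsExpansion.momentB_one_zero_one (h : IsExpansion g γ Δ nth 4 K L) (hγ : 0 < γ)
    (hn : 0 ≤ nth) (ρ : OpB) : momentB 0 1 (K 1 ρ) = (2 * coupling g γ / gammaBar γ Δ) •
      !![-nth * ρ 0 1, 0; (1 + nth) * ρ 0 0 - nth * ρ 1 1, (1 + nth) * ρ 0 1] := by
  have hu := gammaBar_ne_zero hγ Δ
  refine smul_right_injective_OpB (rate_ne_zero hγ Δ (show 0 < 0 + 1 by norm_num)) ?_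
  rw [h.momentB_one hγ hn, momentB_comm _ _ (h.rapid 0 (by norm_num) ρ), rate_eq]
  simp only [h.momentB_zero_order hγ hn]
  ext i l
  fin_cases i <;> fin_cases l <;> simp <;> field_simp <;> ring

theorem IsExpansion.momentB_one_one_zero (h : IsExpansion g γ Δ nth 4 K L) (hγ : 0 < γ)
    (hn : 0 ≤ nth) (ρ : OpB) : momentB 1 0 (K 1 ρ) = (2 * coupling g γ / gammaBarConj γ Δ) •
      !![nth * ρ 1 0, nth * ρ 1 1 - (1 + nth) * ρ 0 0; 0, -(1 + nth) * ρ 1 0] := by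
  have hv := gammaBarConj_ne_zero hγ Δ
  refine smul_right_injective_OpB (rate_ne_zero hγ Δ (show 0 < 1 + 0 by norm_num)) ?_
  rw [h.momentB_one hγ hn, momentB_comm _ _ (h.rapid 0 (by norm_num) ρ), rate_eq]
  simp only [h.momentB_zero_order hγ hn]
  ext i l
  fin_cases i <;> fin_cases l <;> simp <;> field_simp <;> ring

/-- A selection rule: the source consists of thermal moments at neighbours of `(j, k)`, nonzero only
on the diagonal. Having `j = 0` or `k = 0` removes the coupling to a lower moment. -/
theorem IsExpansion.momentB_one_eq_zero (h : IsExpansion g γ Δ nth 4 K L) (hγ : 0 < γ)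
    (hn : 0 ≤ nth) {j k : ℕ} (hjk : 0 < j + k) (h0 : j = 0 ∨ k = 0) (h1 : j ≠ k + 1)
    (h2 : k ≠ j + 1) (ρ : OpB) : momentB j k (K 1 ρ) = 0 := by
  refine smul_right_injective_OpB (rate_ne_zero hγ Δ hjk) ?_
  rw [h.momentB_one hγ hn, momentB_comm _ _ (h.rapid 0 (by norm_num) ρ)]
  simp only [h.momentB_zero_order hγ hn]
  rcases h0 with rfl | rfl
  · have h4 : ¬ 1 = k := by omega
    have h5 : ¬ 0 = k - 1 := by omega
    ext i l
    fin_cases i <;> fin_cases l <;> simp [h4, h5]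
  · have h3 : ¬ j = 1 := by omega
    have h5 : ¬ j - 1 = 0 := by omega
    ext i l
    fin_cases i <;> fin_cases l <;> simp [h3, h5]

theorem IsExpansion.momentB_one_one_one (h : IsExpansion g γ Δ nth 4 K L) (hγ : 0 < γ)
    (hn : 0 ≤ nth) (ρ : OpB) : momentB 1 1 (K 1 ρ) = 0 := by
  refine smul_right_injective_OpB (rate_ne_zero hγ Δ (show 0 < 1 + 1 by norm_num)) ?_
  rw [h.momentB_one hγ hn, momentB_comm _ _ (h.rapid 0 (by norm_num) ρ)]
  simp only [h.momentB_zero_order hγ hn, Nat.sub_self, h.momentB_zero_zero_succ 0 (by norm_num)]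
  ext i l
  fin_cases i <;> fin_cases l <;> simp

theorem IsExpansion.momentB_one_one_two (h : IsExpansion g γ Δ nth 4 K L) (hγ : 0 < γ)
    (hn : 0 ≤ nth) (ρ : OpB) :
    momentB 1 2 (K 1 ρ) = (2 * nth : ℂ) • momentB 0 1 (K 1 ρ) := by
  have hu := gammaBar_ne_zero hγ Δ
  refine smul_right_injective_OpB (rate_ne_zero hγ Δ (show 0 < 1 + 2 by norm_num)) ?_
  rw [h.momentB_one hγ hn, momentB_comm _ _ (h.rapid 0 (by norm_num) ρ), rate_eq,
    Nat.sub_self, h.momentB_one_zero_one hγ hn, gamma_eq γ Δ]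
  simp only [h.momentB_zero_order hγ hn]
  ext i l
  fin_cases i <;> fin_cases l <;> simp [Nat.factorial] <;> field_simp <;> ring

theorem IsExpansion.momentB_one_two_one (h : IsExpansion g γ Δ nth 4 K L) (hγ : 0 < γ)
    (hn : 0 ≤ nth) (ρ : OpB) :
    momentB 2 1 (K 1 ρ) = (2 * nth : ℂ) • momentB 1 0 (K 1 ρ) := by
  have hv := gammaBarConj_ne_zero hγ Δ
  refine smul_right_injective_OpB (rate_ne_zero hγ Δ (show 0 < 2 + 1 by norm_num)) ?_
  rw [h.momentB_one hγ hn, momentB_comm _ _ (h.rapid 0 (by norm_num) ρ), rate_eq,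
    Nat.sub_self, h.momentB_one_one_zero hγ hn, gamma_eq γ Δ]
  simp only [h.momentB_zero_order hγ hn]
  ext i l
  fin_cases i <;> fin_cases l <;> simp [Nat.factorial] <;> field_simp <;> ring

theorem IsExpansion.L_two (h : IsExpansion g γ Δ nth 4 K L) (hγ : 0 < γ) (hn : 0 ≤ nth)
    (ρ : OpB) : L 2 ρ = (2 * coupling g γ ^ 2) •
      !![(1 / gammaBar γ Δ + 1 / gammaBarConj γ Δ) * ((1 + nth) * ρ 0 0 - nth * ρ 1 1),
        (1 + 2 * nth) * ρ 0 1 / gammaBar γ Δ;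
        (1 + 2 * nth) * ρ 1 0 / gammaBarConj γ Δ,
        -(1 / gammaBar γ Δ + 1 / gammaBarConj γ Δ) * ((1 + nth) * ρ 0 0 - nth * ρ 1 1)] := by
  have hu := gammaBar_ne_zero hγ Δ
  have hv := gammaBarConj_ne_zero hγ Δ
  rw [h.L_succ hγ hn 1 (by norm_num), momentB_comm _ _ (h.rapid 1 (by norm_num) ρ)]
  simp only [zero_add, h.momentB_one_zero_one hγ hn, h.momentB_one_one_zero hγ hn]
  ext i l
  fin_cases i <;> fin_cases l <;> simp <;> field_simp <;> ring

theorem IsExpansion.momentB_two (h : IsExpansion g γ Δ nth 4 K L) (hγ : 0 < γ) (hn : 0 ≤ nth)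
    (j k : ℕ) (ρ : OpB) :
    rate γ Δ j k • momentB j k (K 2 ρ)
      = (if j = k then (j.factorial : ℂ) * (nth : ℂ) ^ j else 0) • L 2 ρ
        - (γ * nth * j * k : ℂ) • momentB (j - 1) (k - 1) (K 2 ρ)
        - coupling g γ • momentB j k (comm hamInt (K 1 ρ)) := by
  rw [h.momentB_succ 1 (by norm_num), Finset.sum_range_succ, Finset.sum_range_one]
  simp only [h.L_one hγ hn, map_zero, momentB_zero, add_zero, h.momentB_zero_order hγ hn]

/-- Parity: the source involves only first-order moments of even degree, which vanish. This is why
`L 3` is zero. -/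
theorem IsExpansion.momentB_two_zero_one (h : IsExpansion g γ Δ nth 4 K L) (hγ : 0 < γ)
    (hn : 0 ≤ nth) (ρ : OpB) : momentB 0 1 (K 2 ρ) = 0 := by
  refine smul_right_injective_OpB (rate_ne_zero hγ Δ (show 0 < 0 + 1 by norm_num)) ?_
  rw [h.momentB_two hγ hn, momentB_comm _ _ (h.rapid 1 (by norm_num) ρ)]
  ext i l
  fin_cases i <;> fin_cases l <;> simp [h.momentB_one_one_one hγ hn, h.momentB_zero_zero_succ 0,
    h.momentB_one_eq_zero hγ hn (j := 0) (k := 2)]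

theorem IsExpansion.momentB_two_one_zero (h : IsExpansion g γ Δ nth 4 K L) (hγ : 0 < γ)
    (hn : 0 ≤ nth) (ρ : OpB) : momentB 1 0 (K 2 ρ) = 0 := by
  refine smul_right_injective_OpB (rate_ne_zero hγ Δ (show 0 < 1 + 0 by norm_num)) ?_
  rw [h.momentB_two hγ hn, momentB_comm _ _ (h.rapid 1 (by norm_num) ρ)]
  ext i l
  fin_cases i <;> fin_cases l <;> simp [h.momentB_one_one_one hγ hn, h.momentB_zero_zero_succ 0,
    h.momentB_one_eq_zero hγ hn (j := 2) (k := 0)]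

theorem IsExpansion.momentB_two_zero_two (h : IsExpansion g γ Δ nth 4 K L) (hγ : 0 < γ)
    (hn : 0 ≤ nth) (ρ : OpB) : momentB 0 2 (K 2 ρ) =
      (-8 * coupling g γ ^ 2 * nth * (1 + nth) / gammaBar γ Δ ^ 2) • !![0, 0; ρ 0 1, 0] := by
  have hu := gammaBar_ne_zero hγ Δ
  refine smul_right_injective_OpB (rate_ne_zero hγ Δ (show 0 < 0 + 2 by norm_num)) ?_
  rw [h.momentB_two hγ hn, momentB_comm _ _ (h.rapid 1 (by norm_num) ρ), rate_eq]
  simp only [zero_add, Nat.add_one_sub_one, Nat.reduceSub, Nat.reduceAdd,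
    h.momentB_one_one_two hγ hn, h.momentB_one_zero_one hγ hn,
    h.momentB_one_eq_zero hγ hn (j := 0) (k := 3) (by norm_num) (by norm_num) (by norm_num)
      (by norm_num)]
  ext i l
  fin_cases i <;> fin_cases l <;> simp
  field_simp
  ring

theorem IsExpansion.momentB_two_two_zero (h : IsExpansion g γ Δ nth 4 K L) (hγ : 0 < γ)
    (hn : 0 ≤ nth) (ρ : OpB) : momentB 2 0 (K 2 ρ) =
      (-8 * coupling g γ ^ 2 * nth * (1 + nth) / gammaBarConj γ Δ ^ 2) • !![0, ρ 1 0; 0, 0] := by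
  have hv := gammaBarConj_ne_zero hγ Δ
  refine smul_right_injective_OpB (rate_ne_zero hγ Δ (show 0 < 2 + 0 by norm_num)) ?_
  rw [h.momentB_two hγ hn, momentB_comm _ _ (h.rapid 1 (by norm_num) ρ), rate_eq]
  simp only [zero_add, Nat.add_one_sub_one, Nat.reduceSub, Nat.reduceAdd,
    h.momentB_one_two_one hγ hn, h.momentB_one_one_zero hγ hn,
    h.momentB_one_eq_zero hγ hn (j := 3) (k := 0) (by norm_num) (by norm_num) (by norm_num)
      (by norm_num)]
  ext i l
  fin_cases i <;> fin_cases l <;> simp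
  field_simp
  ring

theorem IsExpansion.momentB_two_one_one (h : IsExpansion g γ Δ nth 4 K L) (hγ : 0 < γ)
    (hn : 0 ≤ nth) (ρ : OpB) : momentB 1 1 (K 2 ρ) = (4 * coupling g γ ^ 2) •
      !![nth * ((1 + nth) * ρ 0 0 - nth * ρ 1 1) / (gammaBar γ Δ * gammaBarConj γ Δ),
        2 * nth * (1 + nth) * ρ 0 1 / (gammaBar γ Δ * (gammaBar γ Δ + gammaBarConj γ Δ));
        2 * nth * (1 + nth) * ρ 1 0 / (gammaBarConj γ Δ * (gammaBar γ Δ + gammaBarConj γ Δ)),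
        -(1 + nth) * ((1 + nth) * ρ 0 0 - nth * ρ 1 1) / (gammaBar γ Δ * gammaBarConj γ Δ)] := by
  have hu := gammaBar_ne_zero hγ Δ
  have hv := gammaBarConj_ne_zero hγ Δ
  have huv := gammaBar_add_ne_zero hγ Δ
  refine smul_right_injective_OpB (rate_ne_zero hγ Δ (show 0 < 1 + 1 by norm_num)) ?_
  rw [h.momentB_two hγ hn, momentB_comm _ _ (h.rapid 1 (by norm_num) ρ), rate_eq, Nat.sub_self,
    h.momentB_zero_zero_succ 1 (by norm_num), h.L_two hγ hn]
  simp only [Nat.reduceAdd,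
    h.momentB_one_two_one hγ hn, h.momentB_one_one_zero hγ hn,
    h.momentB_one_one_two hγ hn, h.momentB_one_zero_one hγ hn]
  ext i l
  fin_cases i <;> fin_cases l <;> simp <;> field_simp <;> ring

theorem IsExpansion.L_three (h : IsExpansion g γ Δ nth 4 K L) (hγ : 0 < γ) (hn : 0 ≤ nth)
    (ρ : OpB) : L 3 ρ = 0 := by
  rw [h.L_succ hγ hn 2 (by norm_num), momentB_comm _ _ (h.rapid 2 (by norm_num) ρ)]
  ext i l
  fin_cases i <;> fin_cases l <;>
    simp [h.momentB_two_zero_one hγ hn, h.momentB_two_one_zero hγ hn]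

theorem IsExpansion.momentB_three (h : IsExpansion g γ Δ nth 4 K L) (hγ : 0 < γ) (hn : 0 ≤ nth)
    (j k : ℕ) (ρ : OpB) :
    rate γ Δ j k • momentB j k (K 3 ρ)
      = momentB j k (K 1 (L 2 ρ))
        - (γ * nth * j * k : ℂ) • momentB (j - 1) (k - 1) (K 3 ρ)
        - coupling g γ • momentB j k (comm hamInt (K 2 ρ)) := by
  rw [h.momentB_succ 2 (by norm_num), Finset.sum_range_succ, Finset.sum_range_succ,
    Finset.sum_range_one]
  simp only [h.L_one hγ hn, h.L_three hγ hn, map_zero, momentB_zero, add_zero, zero_add,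
    Nat.reduceAdd, Nat.reduceSub, Nat.sub_zero]

end Expansion

/-! ### The fourth-order term of the reduced generator -/

section Expansion

variable {g γ Δ nth : ℝ} {K : ℕ → OpB →ₗ[ℂ] OpAB} {L : ℕ → OpB →ₗ[ℂ] OpB}

/-- The fourth-order part of `b_±` at `g = 1`, as a function of `u = γ + 2iΔ` and `v = γ - 2iΔ`. -/
def bFour (n p q u v : ℂ) : ℂ :=
  8 * n ^ 2 / u ^ 3 + 8 * p * q * (1 + (u ^ 2 - v ^ 2) / (u * v)) / (v * (u * v))

/-- The dephasing coefficient at `g = 1`, as a function of `u = γ + 2iΔ` and `v = γ - 2iΔ`. -/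
def phiFour (p q u v : ℂ) : ℂ :=
  -(p * q * (3 * (u + v) ^ 4 + 6 * (u - v) ^ 2 * (u + v) ^ 2 - (u - v) ^ 4))
    / ((u + v) * (u * v) ^ 3)

/-- The prefactor is the inverse rate at `(0, 1)`. The memory term `K 1 (L 2 ρ)` appears here for
the first time; the right side stays unexpanded until `IsExpansion.L_four`. -/
theorem IsExpansion.momentB_three_zero_one (h : IsExpansion g γ Δ nth 4 K L) (hγ : 0 < γ)
    (hn : 0 ≤ nth) (ρ : OpB) : momentB 0 1 (K 3 ρ) = (-2 / gammaBar γ Δ) •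
      (momentB 0 1 (K 1 (L 2 ρ)) - coupling g γ • momentB 0 1 (comm hamInt (K 2 ρ))) := by
  have hu := gammaBar_ne_zero hγ Δ
  have e := h.momentB_three hγ hn 0 1 ρ
  rw [rate_eq, Nat.cast_zero, mul_zero, zero_mul, zero_mul, zero_smul, sub_zero] at e
  rw [← e, smul_smul]
  convert (one_smul ℂ _).symm
  push_cast
  field_simp
  ring

theorem IsExpansion.momentB_three_one_zero (h : IsExpansion g γ Δ nth 4 K L) (hγ : 0 < γ)
    (hn : 0 ≤ nth) (ρ : OpB) : momentB 1 0 (K 3 ρ) = (-2 / gammaBarConj γ Δ) •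
      (momentB 1 0 (K 1 (L 2 ρ)) - coupling g γ • momentB 1 0 (comm hamInt (K 2 ρ))) := by
  have hv := gammaBarConj_ne_zero hγ Δ
  have e := h.momentB_three hγ hn 1 0 ρ
  rw [rate_eq, Nat.cast_zero, mul_zero, zero_smul, sub_zero] at e
  rw [← e, smul_smul]
  convert (one_smul ℂ _).symm
  push_cast
  field_simp
  ring

/-- The populations identify the fourth-order parts of `γ_±`. The coherences then decay differently
from what those rates and the frequency shift account for, and the excess is the dephasing
`phiFour`. The variables `u`, `v`, `p`, `q` make this a rational identity subject only to `q = 1 +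
p`. -/
theorem IsExpansion.L_four (h : IsExpansion g γ Δ nth 4 K L) (hγ : 0 < γ) (hn : 0 ≤ nth)
    (ρ : OpB) (u v p q : ℂ) (hu : u = gammaBar γ Δ) (hv : v = gammaBarConj γ Δ) (hp : p = nth)
    (hq : q = 1 + nth) : L 4 ρ = (coupling g γ ^ 4) •
      !![-(bFour q p q u v + bFour q p q v u) * ρ 0 0 + (bFour p p q u v + bFour p p q v u) * ρ 1 1,
        (-(bFour q p q u v + bFour p p q u v) - 2 * phiFour p q u v) * ρ 0 1;
        (-(bFour q p q v u + bFour p p q v u) - 2 * phiFour p q u v) * ρ 1 0,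
        (bFour q p q u v + bFour q p q v u) * ρ 0 0
          - (bFour p p q u v + bFour p p q v u) * ρ 1 1] := by
  have hu0 : u ≠ 0 := hu ▸ gammaBar_ne_zero hγ Δ
  have hv0 : v ≠ 0 := hv ▸ gammaBarConj_ne_zero hγ Δ
  have huv : u + v ≠ 0 := by rw [hu, hv]; exact gammaBar_add_ne_zero hγ Δ
  rw [h.L_succ hγ hn 3 (by norm_num), momentB_comm _ _ (h.rapid 3 (by norm_num) ρ)]
  simp only [zero_add, h.momentB_three_zero_one hγ hn, h.momentB_three_one_zero hγ hn,
    momentB_comm _ _ (h.rapid 2 (by norm_num) ρ), Nat.reduceAdd, Nat.sub_self,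
    h.momentB_one_zero_one hγ hn, h.momentB_one_one_zero hγ hn, h.momentB_two_zero_two hγ hn,
    h.momentB_two_two_zero hγ hn, h.momentB_two_one_one hγ hn,
    h.momentB_zero_zero_succ 1 (by norm_num), h.L_two hγ hn, ← hu, ← hv, ← hp]
  have hqp : (1 + 2 * p : ℂ) = p + q := by rw [hq, hp]; ring
  have hq' : q = 1 + p := by rw [hq, hp]
  rw [hqp]
  ext i l
  fin_cases i <;> fin_cases l <;> simp [bFour, phiFour] <;> subst hq' <;> field_simp <;> ring

end Expansion

/-! ### The reduced generator in terms of its coefficients -/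

theorem opMul_eq_mul (A B : OpB) : opMul A B = A * B := by
  ext i j
  rw [opMul, tsum_fintype, Matrix.mul_apply]

theorem comm_sigmaZ (ρ : OpB) : comm sigmaZ ρ = !![0, 2 * ρ 0 1; -2 * ρ 1 0, 0] := by
  rw [comm, opMul_eq_mul, opMul_eq_mul]
  ext i j
  fin_cases i <;> fin_cases j <;> simp [sigmaZ, Matrix.vecMul, dotProduct, Matrix.mul_apply, Fin.sum_univ_two] <;> ring

theorem dissipator_sigmaMinus (ρ : OpB) :
    dissipator sigmaMinus ρ = !![-ρ 0 0, -(ρ 0 1 / 2); -(ρ 1 0 / 2), ρ 0 0] := by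
  simp only [dissipator, opMul_eq_mul, sigmaMinus_eq]
  ext i j
  fin_cases i <;> fin_cases j <;>
    simp [Matrix.vecMul, dotProduct, Matrix.mul_apply, Fin.sum_univ_two] <;> ring

theorem dissipator_sigmaPlus (ρ : OpB) :
    dissipator sigmaPlus ρ = !![ρ 1 1, -(ρ 0 1 / 2); -(ρ 1 0 / 2), -ρ 1 1] := by
  simp only [dissipator, opMul_eq_mul, sigmaPlus_eq]
  ext i j
  fin_cases i <;> fin_cases j <;>
    simp [Matrix.vecMul, dotProduct, Matrix.mul_apply, Fin.sum_univ_two] <;> ring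

theorem dissipator_sigmaZ (ρ : OpB) :
    dissipator sigmaZ ρ = !![0, -2 * ρ 0 1; -2 * ρ 1 0, 0] := by
  simp only [dissipator, opMul_eq_mul, sigmaZ]
  ext i j
  fin_cases i <;> fin_cases j <;>
    simp [Matrix.vecMul, dotProduct, Matrix.mul_apply, Fin.sum_univ_two] <;> ring

theorem conj_gammaBar (γ Δ : ℝ) : starRingEnd ℂ (gammaBar γ Δ) = gammaBarConj γ Δ := by
  simp [gammaBar, gammaBarConj, sub_eq_add_neg, map_ofNat]

theorem norm_gammaBar_sq (γ Δ : ℝ) :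
    (‖gammaBar γ Δ‖ : ℂ) ^ 2 = gammaBar γ Δ * gammaBarConj γ Δ := by
  rw [← conj_gammaBar, Complex.mul_conj']

theorem bCoeff_eq (g γ Δ nth n : ℝ) : bCoeff g γ Δ nth n =
    2 * g ^ 2 * n / gammaBar γ Δ
      + g ^ 4 * bFour n nth (1 + nth) (gammaBar γ Δ) (gammaBarConj γ Δ) := by
  have e : 8 * Complex.I * (γ : ℂ) * (Δ : ℂ) = gammaBar γ Δ ^ 2 - gammaBarConj γ Δ ^ 2 := by
    rw [gammaBar, gammaBarConj]; ring
  rw [bCoeff, conj_gammaBar, norm_gammaBar_sq, e, bFour, nPlus, nMinus]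
  push_cast
  ring

theorem conj_bCoeff (g γ Δ nth n : ℝ) : starRingEnd ℂ (bCoeff g γ Δ nth n) =
    2 * g ^ 2 * n / gammaBarConj γ Δ
      + g ^ 4 * bFour n nth (1 + nth) (gammaBarConj γ Δ) (gammaBar γ Δ) := by
  have e : starRingEnd ℂ (gammaBarConj γ Δ) = gammaBar γ Δ := by
    rw [← conj_gammaBar, Complex.conj_conj]
  rw [bCoeff_eq, bFour, bFour]
  simp only [map_add, map_mul, map_div₀, map_pow, map_sub, conj_gammaBar, e, Complex.conj_ofReal,
    map_one, map_ofNat]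

/-- `phiFour` depends on `u`, `v` only through `u + v`, `(u - v) ^ 2` and `u v`, all of which are
real here. -/
theorem gammaPhi_eq (g : ℝ) {γ : ℝ} (hγ : 0 < γ) (Δ nth : ℝ) : ((gammaPhi g γ Δ nth : ℝ) : ℂ) =
    g ^ 4 * phiFour nth (1 + nth) (gammaBar γ Δ) (gammaBarConj γ Δ) := by
  have h1 : (γ : ℂ) ≠ 0 := by exact_mod_cast hγ.ne'
  have h2 : ((γ : ℂ) ^ 2 + (2 * Δ) ^ 2) ≠ 0 := by
    exact_mod_cast (by positivity : γ ^ 2 + (2 * Δ) ^ 2 ≠ 0)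
  have e1 : gammaBar γ Δ + gammaBarConj γ Δ = 2 * γ := by rw [gammaBar, gammaBarConj]; ring
  have e2 : (gammaBar γ Δ - gammaBarConj γ Δ) ^ 2 = -(4 * (2 * Δ) ^ 2) := by
    rw [gammaBar, gammaBarConj]; ring_nf; rw [Complex.I_sq]; ring
  have e3 : gammaBar γ Δ * gammaBarConj γ Δ = γ ^ 2 + (2 * Δ) ^ 2 := by
    rw [gammaBar, gammaBarConj]; ring_nf; rw [Complex.I_sq]; ring
  have e4 : (gammaBar γ Δ - gammaBarConj γ Δ) ^ 4 = 16 * (2 * Δ) ^ 4 := by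
    rw [show (4 : ℕ) = 2 * 2 from rfl, pow_mul, e2]; ring
  have h3 : 1 + (2 * (Δ : ℂ) / γ) ^ 2 ≠ 0 := by
    rw [div_pow, one_add_div (pow_ne_zero 2 h1)]
    exact div_ne_zero h2 (pow_ne_zero 2 h1)
  rw [phiFour, e1, e2, e3, e4, gammaPhi, nPlus, nMinus]
  push_cast
  rw [← mul_div_assoc, div_eq_div_iff (mul_ne_zero (pow_ne_zero 3 h1) (pow_ne_zero 3 h3))
    (mul_ne_zero (mul_ne_zero two_ne_zero h1) (pow_ne_zero 3 h2))]
  field_simp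
  ring

theorem ofReal_gammaMinus (g γ Δ nth : ℝ) : ((gammaMinus g γ Δ nth : ℝ) : ℂ) =
    bCoeff g γ Δ nth (nMinus nth) + starRingEnd ℂ (bCoeff g γ Δ nth (nMinus nth)) := by
  rw [gammaMinus, Complex.add_conj]

theorem ofReal_gammaPlus (g γ Δ nth : ℝ) : ((gammaPlus g γ Δ nth : ℝ) : ℂ) =
    bCoeff g γ Δ nth (nPlus nth) + starRingEnd ℂ (bCoeff g γ Δ nth (nPlus nth)) := by
  rw [gammaPlus, Complex.add_conj]

theorem I_mul_omegaB (g γ Δ nth : ℝ) :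
    -Complex.I * ((omegaB g γ Δ nth / 2 : ℝ) : ℂ) =
      -((bCoeff g γ Δ nth (nMinus nth) - starRingEnd ℂ (bCoeff g γ Δ nth (nMinus nth)))
        + (bCoeff g γ Δ nth (nPlus nth) - starRingEnd ℂ (bCoeff g γ Δ nth (nPlus nth)))) / 4 := by
  rw [Complex.sub_conj, Complex.sub_conj, omegaB, Complex.add_im]
  push_cast
  ring

theorem IsExpansion.reduced_generator {g γ Δ nth : ℝ} {K : ℕ → OpB →ₗ[ℂ] OpAB}
    {L : ℕ → OpB →ₗ[ℂ] OpB} (h : IsExpansion g γ Δ nth 4 K L) (hγ : 0 < γ) (hn : 0 ≤ nth)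
    (ρ : OpB) :
    ∑ n ∈ Finset.range 5, ((epsilon g γ : ℝ) : ℂ) ^ n • L n ρ =
      (-Complex.I * ((omegaB g γ Δ nth / 2 : ℝ) : ℂ)) • comm sigmaZ ρ
        + ((gammaMinus g γ Δ nth : ℝ) : ℂ) • dissipator sigmaMinus ρ
        + ((gammaPlus g γ Δ nth : ℝ) : ℂ) • dissipator sigmaPlus ρ
        + ((gammaPhi g γ Δ nth : ℝ) : ℂ) • dissipator sigmaZ ρ := by
  have hc := epsilon_mul_coupling g hγ
  have h2 : ((epsilon g γ : ℝ) : ℂ) ^ 2 * coupling g γ ^ 2 = -(g : ℂ) ^ 2 := by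
    rw [← mul_pow, hc, mul_pow, neg_sq, Complex.I_sq]; ring
  have h4 : ((epsilon g γ : ℝ) : ℂ) ^ 4 * coupling g γ ^ 4 = (g : ℂ) ^ 4 := by
    rw [← mul_pow, hc, mul_pow, neg_pow, Complex.I_pow_four]; ring
  rw [Finset.sum_range_succ, Finset.sum_range_succ, Finset.sum_range_succ, Finset.sum_range_succ,
    Finset.sum_range_one, h.L_zero, h.L_one hγ hn, h.L_three hγ hn, h.L_two hγ hn,
    h.L_four hγ hn ρ _ _ _ _ rfl rfl rfl rfl, LinearMap.zero_apply, smul_zero, smul_zero,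
    smul_zero, zero_add, zero_add, add_zero, smul_smul, smul_smul, h4, mul_left_comm, h2,
    comm_sigmaZ, dissipator_sigmaMinus, dissipator_sigmaPlus, dissipator_sigmaZ, I_mul_omegaB,
    ofReal_gammaMinus, ofReal_gammaPlus, gammaPhi_eq g hγ, conj_bCoeff, conj_bCoeff, bCoeff_eq,
    bCoeff_eq, nPlus, nMinus]
  -- The fourth-order quantities enter linearly from here on, so they can be treated as atoms.
  generalize phiFour _ _ _ _ = F
  push_cast
  generalize bFour _ _ _ _ _ = B₁
  generalize bFour (1 + (nth : ℂ)) _ _ _ _ = B₂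
  generalize bFour (nth : ℂ) _ _ (gammaBar γ Δ) _ = B₃
  generalize bFour (nth : ℂ) _ _ _ _ = B₄
  ext i j
  fin_cases i <;> fin_cases j <;> simp <;> ring

theorem gammaPhi_neg {g γ Δ nth : ℝ} (hγ : 0 < γ) (hg : g ≠ 0) (hn : 0 < nth)
    (hΔ : |Δ| / γ < Real.sqrt (2 * Real.sqrt 3 - 3) / 2) : gammaPhi g γ Δ nth < 0 := by
  have h3 : Real.sqrt 3 ^ 2 = 3 := Real.sq_sqrt (by norm_num)
  have h0 : 0 < 2 * Real.sqrt 3 - 3 := by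
    nlinarith [Real.sqrt_nonneg 3]
  have hx : (2 * Δ / γ) ^ 2 < 2 * Real.sqrt 3 - 3 := by
    have h1 : 2 * (|Δ| / γ) < Real.sqrt (2 * Real.sqrt 3 - 3) := by linarith
    have h2 : (2 * (|Δ| / γ)) ^ 2 < 2 * Real.sqrt 3 - 3 := (Real.lt_sqrt (by positivity)).1 h1
    calc (2 * Δ / γ) ^ 2 = (2 * (|Δ| / γ)) ^ 2 := by rw [mul_pow, div_pow, div_pow, sq_abs]; ring
      _ < _ := h2
  -- With `y = (2Δ/γ)^2 ≥ 0` this is `3 - 6y - y^2`, decreasing in `y`, with positive root `2√3 -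
  -- 3`.
  have hpos : 0 < 3 - 6 * (2 * Δ / γ) ^ 2 - (2 * Δ / γ) ^ 4 := by
    nlinarith [sq_nonneg (2 * Δ / γ)]
  have hg4 : 0 < g ^ 4 := by positivity
  rw [gammaPhi, neg_div, neg_lt_zero, nPlus, nMinus]
  positivity

end JaynesCummings

end

theorem mainTheorem4 (g γ Δ nth : ℝ) (hγ : 0 < γ) (hn : 0 ≤ nth) :
    (∃ (K : ℕ → JaynesCummings.OpB →ₗ[ℂ] JaynesCummings.OpAB)
        (L : ℕ → JaynesCummings.OpB →ₗ[ℂ] JaynesCummings.OpB),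
        ∀ N : ℕ, JaynesCummings.IsExpansion g γ Δ nth N K L) ∧
    (∀ (K : ℕ → JaynesCummings.OpB →ₗ[ℂ] JaynesCummings.OpAB)
        (L : ℕ → JaynesCummings.OpB →ₗ[ℂ] JaynesCummings.OpB),
        JaynesCummings.IsExpansion g γ Δ nth 4 K L →
        ∀ ρ : JaynesCummings.OpB,
          ∑ n ∈ Finset.range 5, ((JaynesCummings.epsilon g γ : ℝ) : ℂ) ^ n • L n ρ =
            (-Complex.I * ((JaynesCummings.omegaB g γ Δ nth / 2 : ℝ) : ℂ)) •
                JaynesCummings.comm JaynesCummings.sigmaZ ρ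
              + ((JaynesCummings.gammaMinus g γ Δ nth : ℝ) : ℂ) •
                  JaynesCummings.dissipator JaynesCummings.sigmaMinus ρ
              + ((JaynesCummings.gammaPlus g γ Δ nth : ℝ) : ℂ) •
                  JaynesCummings.dissipator JaynesCummings.sigmaPlus ρ
              + ((JaynesCummings.gammaPhi g γ Δ nth : ℝ) : ℂ) •
                  JaynesCummings.dissipator JaynesCummings.sigmaZ ρ) ∧
    (g ≠ 0 → 0 < nth → |Δ| / γ < Real.sqrt (2 * Real.sqrt 3 - 3) / 2 →
        JaynesCummings.gammaPhi g γ Δ nth < 0) :=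
  ⟨JaynesCummings.exists_expansion g hγ Δ hn,
    fun _ _ h ρ => h.reduced_generator hγ hn ρ,
    fun hg hn' hΔ => JaynesCummings.gammaPhi_neg hγ hg hn' hΔ⟩
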